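/- Fix an integer $c \ge 2$. For each $n$ let $G_n$ be a random simple graph on the vertex set $\{1,\dots,n\}$ (with an arbitrary distribution; deterministic graphs are included), and let $Y_{n,1},\dots,Y_{n,n}$ be i.i.d. uniform on $\{1,\dots,c\}$, with the vector $(Y_{n,1},\dots,Y_{n,n})$ independent of $G_n$. Let $|E(G_n)|$ be the number of edges of $G_n$, let $$N(G_n)=\sum_{(i,j)\in E(G_n),\ i<j}\mathbf 1\{Y_{n,i}=Y_{n,j}\}$$ be the number of monochromatic edges, and let $N(C_4,G_n)$ be the number of subgraphs of $G_n$ isomorphic to the 4-cycle $C_4$. Assume that $|E(G_n)|\to\infty$ in probability, that is, $\mathbb P(|E(G_n)|\le M)\to 0$ as $n\to\infty$ for every real $M$. Then $$\frac{1}{\sqrt{|E(G_n)|/c}}\left(N(G_n)-\frac{|E(G_n)|}{c}\right)\ \longrightarrow\ N\left(0,\,1-\frac1c\right)\quad\text{in distribution}$$ if and only if $N(C_4,G_n)=o_P(|E(G_n)|^2)$, that is, $N(C_4,G_n)/|E(G_n)|^2\to 0$ in probability as $n\to\infty$. (On the event that $G_n$ has no edges, whose probability tends to $0$, both quotients are read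 as $0$.) -/

import Mathlib

open MeasureTheory ProbabilityTheory Filter
open scoped Topology ENNReal

namespace MonoEdges

/-- The number of edges of a graph on the vertex set `Fin n`. -/
noncomputable def edgeCount {n : ℕ} (G : SimpleGraph (Fin n)) : ℕ := G.edgeSet.ncard

open Classical in
/-- The number of monochromatic edges of `G` under the coloring `y`:
the sum over `i < j` of the indicator that `i j` is an edge and `y i = y j`. -/
noncomputable def monoEdges {n c : ℕ} (G : SimpleGraph (Fin n)) (y : Fin n → Fin c) : ℕ :=
  ∑ i : Fin n, ∑ j ∈ Finset.Ioi i, if G.Adj i j ∧ y i = y j then 1 else 0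

/-- The number of copies of the 4-cycle in `G`, that is, the number of subgraphs of `G`
isomorphic to the 4-cycle. -/
noncomputable def fourCycleCount {n : ℕ} (G : SimpleGraph (Fin n)) : ℕ :=
  G.copyCount (SimpleGraph.cycleGraph 4)

/-- The normalized number of monochromatic edges, `(N(G) - |E(G)|/c) / √(|E(G)|/c)`. -/
noncomputable def normalizedCount {n c : ℕ} (G : SimpleGraph (Fin n)) (y : Fin n → Fin c) : ℝ :=
  ((monoEdges G y : ℝ) - (edgeCount G : ℝ) / c) / √((edgeCount G : ℝ) / c)

/-- A uniform random coloring of `n` vertices with `c` colors: the colors of the vertices are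
independent random variables, each of them uniform on the set of colors. -/
structure IsUniformColoring {Ω : Type*} [MeasurableSpace Ω] (P : Measure Ω) {n c : ℕ}
    (Y : Ω → Fin n → Fin c) : Prop where
  measurable : Measurable Y
  indep : iIndepFun (fun (i : Fin n) (ω : Ω) => Y ω i) P
  uniform : ∀ (i : Fin n) (a : Fin c), P {ω | Y ω i = a} = (c : ℝ≥0∞)⁻¹

/-- Convergence to zero in probability of real random variables `X n`, each of which may live on
its own probability space. -/
def TendstoZeroInProb {Ω : ℕ → Type*} [∀ n, MeasurableSpace (Ω n)] (P : ∀ n, Measure (Ω n))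
    (X : ∀ n, Ω n → ℝ) : Prop :=
  ∀ ε : ℝ, 0 < ε → Tendsto (fun n => P n {ω | ε ≤ |X n ω|}) atTop (𝓝 0)

/-- Convergence to infinity in probability of real random variables `X n`, each of which may live
on its own probability space. -/
def TendstoInftyInProb {Ω : ℕ → Type*} [∀ n, MeasurableSpace (Ω n)] (P : ∀ n, Measure (Ω n))
    (X : ∀ n, Ω n → ℝ) : Prop :=
  ∀ M : ℝ, Tendsto (fun n => P n {ω | X n ω ≤ M}) atTop (𝓝 0)

/-- The asymptotic 4-cycle free condition in probability for a sequence of random graphs: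
the number of 4-cycles of `G n` is `o_P(|E(G n)|²)`. -/
def ACF4InProb {Ω : ℕ → Type*} [∀ n, MeasurableSpace (Ω n)] (P : ∀ n, Measure (Ω n))
    (G : ∀ n, Ω n → SimpleGraph (Fin n)) : Prop :=
  TendstoZeroInProb P
    (fun n ω => (fourCycleCount (G n ω) : ℝ) / (edgeCount (G n ω) : ℝ) ^ 2)

end MonoEdges

open scoped BigOperators

namespace MonoEdges

/-! Conditionally on the graph, with m edges, the centered count `edgeForm` is a sum over edges of a
kernel that has mean zero in each endpoint separately. Both implications are obtained for a fixed
graph with quantitative bounds and then averaged over the graph.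

Few 4-cycles imply normality. Reveal the colors vertex by vertex, in order of decreasing degree. The
form becomes a martingale whose k-th increment is a linear form in the earlier neighbors of k.
Averaging the square of an increment over its color gives a constant plus another quadratic form
(`expect_linForm_sq`), so the fluctuation of the total conditional variance has coefficients given
by codegrees. The squared codegrees are bounded by the number of 4-cycles plus m√(2m)
(`sum_backCodegree_sq_le`), because the degree ordering leaves each vertex at most √(2m) earlier
neighbors (`backDegree_sq_le`). After normalization both the fluctuation and the largest increment
are small, and `norm_expect_exp_quadForm_sub_le`, a martingale CLT proved with characteristic
functions, applies. Its moment inputs come from a smoothness inequality for sixth moments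
(`expect_add_pow_six_le`).

Normality implies few 4-cycles. The kernel is a nonnegative combination of characters of the group
of colorings, so every mixed moment of edge kernels is nonnegative. In the fourth moment of the form
the pairings of edges already give the Gaussian value asymptotically, and each labelled 4-cycle adds
at least c⁻⁴ (`le_expect_edgeForm_pow_four`). Sixth moments are bounded uniformly, so convergence in
distribution bounds the limiting fourth moment by the Gaussian one, which leaves no room for a
positive proportion of 4-cycles. -/

/-- The centered indicator `1{x = y} - 1/c` of a monochromatic pair. -/
noncomputable def matchKernel {c : ℕ} (x y : Fin c) : ℝ := (if x = y then 1 else 0) - 1 / (c : ℝ)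

/-! ### The matching kernel. -/

section Kernel

variable {c : ℕ}

lemma matchKernel_comm (x y : Fin c) : matchKernel x y = matchKernel y x := by
  simp [matchKernel, eq_comm]

lemma matchKernel_self (x : Fin c) : matchKernel x x = 1 - 1 / (c : ℝ) := by
  simp [matchKernel]

variable [NeZero c]

lemma abs_matchKernel_le_one (x y : Fin c) : |matchKernel x y| ≤ 1 := by
  have hc : (1 : ℝ) ≤ c := by exact_mod_cast NeZero.one_le
  have h1 : 1 / (c : ℝ) ≤ 1 := by rw [div_le_one (by positivity)]; exact hc
  have h0 : 0 ≤ 1 / (c : ℝ) := by positivity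
  unfold matchKernel
  split_ifs <;> rw [abs_le] <;> constructor <;> linarith

lemma expect_matchKernel (x : Fin c) : 𝔼 b, matchKernel x b = 0 := by
  simp [matchKernel, Finset.expect_sub_distrib]

lemma expect_matchKernel_left (x : Fin c) : 𝔼 b, matchKernel b x = 0 := by
  simp_rw [matchKernel_comm _ x, expect_matchKernel]

/-- The kernel is the matrix of the orthogonal projection onto mean-zero functions of a color, hence
idempotent. The factor 1/c appears because the composition is an average and not a sum. -/
lemma expect_matchKernel_mul (x x' : Fin c) :
    𝔼 b, matchKernel x b * matchKernel x' b = matchKernel x x' / c := by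
  have h : ∀ b, matchKernel x b * matchKernel x' b =
      (if x = b then matchKernel x' b else 0) - 1 / c * matchKernel x' b := by
    intro b
    conv_lhs => rw [matchKernel]
    split_ifs <;> ring
  simp_rw [h, Finset.expect_sub_distrib, ← Finset.mul_expect, expect_matchKernel]
  rw [mul_zero, sub_zero, Fintype.expect_eq_sum_div_card]
  simp [matchKernel_comm]

end Kernel

/-! ### Resampling one color. -/

section Resample

variable {V C M : Type*} [Fintype V] [DecidableEq V] [Fintype C]
  [AddCommMonoid M] [Module ℚ≥0 M]

/-- Resampling one coordinate does not change the average over all colorings. -/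
lemma expect_expect_update [Nonempty C] (k : V) (F : (V → C) → M) :
    𝔼 y, 𝔼 b, F (Function.update y k b) = 𝔼 y, F y := by
  have h1 : 𝔼 y : V → C, 𝔼 b : C, F (Function.update y k b) =
      𝔼 p : (V → C) × C, F (Function.update p.1 k p.2) := by
    rw [← Finset.univ_product_univ, Finset.expect_product]
  have h2 : 𝔼 y : V → C, F y = 𝔼 p : (V → C) × C, F p.1 := by
    rw [← Finset.univ_product_univ, Finset.expect_product]
    simp
  rw [h1, h2]
  -- The involution exchanges the k-th color with the fresh one.
  refine Fintype.expect_equiv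
    (⟨fun p => (Function.update p.1 k p.2, p.1 k), fun p => (Function.update p.1 k p.2, p.1 k),
      ?_, ?_⟩ : (V → C) × C ≃ (V → C) × C) _ _ ?_
  · intro p; simp
  · intro p; simp
  · intro p; simp

end Resample

/-! ### Smoothness of the sixth moment. -/

section SixthMoment

variable {ι : Type*} [Fintype ι]

/-- Hölder's inequality with exponents 3/2 and 3, proved by a pointwise Young inequality with
weights tuned to A and B. The weights divide by A and B, so the degenerate cases come first. -/
lemma expect_pow_four_mul_sq_le {X Y : ι → ℝ} {A B : ℝ} (hA : 0 ≤ A) (hB : 0 ≤ B)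
    (hX : 𝔼 y, X y ^ 6 ≤ A ^ 3) (hY : 𝔼 y, Y y ^ 6 ≤ B ^ 3) :
    𝔼 y, X y ^ 4 * Y y ^ 2 ≤ A ^ 2 * B := by
  have key : ∀ Z : ι → ℝ, 𝔼 y, Z y ^ 6 ≤ (0 : ℝ) ^ 3 → ∀ y, Z y = 0 := by
    intro Z hZ y
    have h0 : (0 : ι → ℝ) ≤ fun y => Z y ^ 6 := fun y => by positivity
    have h1 : 𝔼 y, Z y ^ 6 = 0 :=
      le_antisymm (by simpa using hZ) (Finset.expect_nonneg fun y _ => by positivity)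
    have := congrFun ((Fintype.expect_eq_zero_iff_of_nonneg h0).1 h1) y
    simpa using this
  rcases hA.eq_or_lt with rfl | hA
  · simp [key X hX]
  rcases hB.eq_or_lt with rfl | hB
  · simp [key Y hY]
  have hpt : ∀ y, X y ^ 4 * Y y ^ 2 ≤
      2 * B / (3 * A) * X y ^ 6 + A ^ 2 / (3 * B ^ 2) * Y y ^ 6 := by
    intro y
    have hu : 0 ≤ X y ^ 2 * B := by positivity
    have hv : 0 ≤ Y y ^ 2 * A := by positivity
    have h := mul_nonneg (sq_nonneg (X y ^ 2 * B - Y y ^ 2 * A))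
      (by positivity : 0 ≤ 2 * (X y ^ 2 * B) + Y y ^ 2 * A)
    have e : 2 * B / (3 * A) * X y ^ 6 + A ^ 2 / (3 * B ^ 2) * Y y ^ 6 - X y ^ 4 * Y y ^ 2 =
      (X y ^ 2 * B - Y y ^ 2 * A) ^ 2 * (2 * (X y ^ 2 * B) + Y y ^ 2 * A) / (3 * A * B ^ 2) := by
      field_simp
      ring
    have : 0 ≤ (X y ^ 2 * B - Y y ^ 2 * A) ^ 2 * (2 * (X y ^ 2 * B) + Y y ^ 2 * A) /
      (3 * A * B ^ 2) := div_nonneg h (by positivity)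
    linarith
  calc 𝔼 y, X y ^ 4 * Y y ^ 2
      ≤ 𝔼 y, (2 * B / (3 * A) * X y ^ 6 + A ^ 2 / (3 * B ^ 2) * Y y ^ 6) :=
        Finset.expect_le_expect fun y _ => hpt y
    _ = 2 * B / (3 * A) * 𝔼 y, X y ^ 6 + A ^ 2 / (3 * B ^ 2) * 𝔼 y, Y y ^ 6 := by
        rw [Finset.expect_add_distrib, Finset.mul_expect, Finset.mul_expect]
    _ ≤ 2 * B / (3 * A) * A ^ 3 + A ^ 2 / (3 * B ^ 2) * B ^ 3 := by gcongr
    _ = A ^ 2 * B := by field_simp; ring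

lemma expect_sq_le_of_pow_six [Nonempty ι] {X : ι → ℝ} {A : ℝ} (hA : 0 ≤ A)
    (hX : 𝔼 y, X y ^ 6 ≤ A ^ 3) : 𝔼 y, X y ^ 2 ≤ A := by
  have h := expect_pow_four_mul_sq_le (X := fun _ : ι => (1 : ℝ)) (A := 1) (Y := X)
    zero_le_one hA (by simp) hX
  simpa using h

/-- Adding a martingale increment: a two-smoothness inequality for the sixth moment. -/
lemma expect_add_pow_six_le {V C : Type*} [Fintype V] [DecidableEq V] [Fintype C] [Nonempty C]
    (k : V) {X Y : (V → C) → ℝ} {A B : ℝ} (hA : 0 ≤ A) (hB : 0 ≤ B)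
    (hXk : ∀ y b, X (Function.update y k b) = X y)
    (hYk : ∀ y, 𝔼 b, Y (Function.update y k b) = 0)
    (hX : 𝔼 y, X y ^ 6 ≤ A ^ 3) (hY : 𝔼 y, Y y ^ 6 ≤ B ^ 3) :
    𝔼 y, (X y + Y y) ^ 6 ≤ (A + 10 * B) ^ 3 := by
  -- The only term linear in the increment vanishes by the martingale property; this is why A enters
  -- the bound with coefficient one.
  have h1 : 𝔼 y, X y ^ 5 * Y y = 0 := by
    rw [← expect_expect_update k]
    simp_rw [hXk, ← Finset.mul_expect, hYk]
    simp
  have h2 := expect_pow_four_mul_sq_le hA hB hX hY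
  have h3 := expect_pow_four_mul_sq_le hB hA hY hX
  -- The odd terms are absorbed by 20X³Y³ ≤ 10X⁴Y² + 10X²Y⁴ and 6XY⁵ ≤ 3X²Y⁴ + 3Y⁶.
  have hpt : ∀ y, (X y + Y y) ^ 6 ≤ X y ^ 6 + 6 * (X y ^ 5 * Y y) + 25 * (X y ^ 4 * Y y ^ 2)
      + 28 * (Y y ^ 4 * X y ^ 2) + 4 * Y y ^ 6 := by
    intro y
    nlinarith [sq_nonneg (X y ^ 2 * Y y - X y * Y y ^ 2), sq_nonneg (X y * Y y ^ 2 - Y y ^ 3)]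
  calc 𝔼 y, (X y + Y y) ^ 6
      ≤ 𝔼 y, (X y ^ 6 + 6 * (X y ^ 5 * Y y) + 25 * (X y ^ 4 * Y y ^ 2)
      + 28 * (Y y ^ 4 * X y ^ 2) + 4 * Y y ^ 6) := Finset.expect_le_expect fun y _ => hpt y
    _ = 𝔼 y, X y ^ 6 + 6 * 𝔼 y, X y ^ 5 * Y y + 25 * 𝔼 y, X y ^ 4 * Y y ^ 2
      + 28 * 𝔼 y, Y y ^ 4 * X y ^ 2 + 4 * 𝔼 y, Y y ^ 6 := by
        simp only [Finset.expect_add_distrib, Finset.mul_expect]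
    _ ≤ A ^ 3 + 25 * (A ^ 2 * B) + 28 * (B ^ 2 * A) + 4 * B ^ 3 := by
        rw [h1]; linarith
    _ ≤ (A + 10 * B) ^ 3 := by
        have := mul_nonneg (sq_nonneg A) hB
        have := mul_nonneg (sq_nonneg B) hA
        have := pow_nonneg hB 3
        nlinarith

end SixthMoment

/-! ### Linear and quadratic forms in the colors. -/

section Forms

variable {V : Type*} {c : ℕ}

/-- The linear form in the colors of the vertices in `s` seen from the color `b`. -/
noncomputable def linForm (x : V → ℝ) (s : Finset V) (b : Fin c) (y : V → Fin c) : ℝ :=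
  ∑ i ∈ s, x i * matchKernel (y i) b

lemma linForm_update_of_notMem [DecidableEq V] {x : V → ℝ} {s : Finset V} {k : V} (hk : k ∉ s) (b b' : Fin c)
    (y : V → Fin c) : linForm x s b (Function.update y k b') = linForm x s b y := by
  refine Finset.sum_congr rfl fun i hi => ?_
  rw [Function.update_of_ne (ne_of_mem_of_not_mem hi hk)]

lemma expect_linForm [NeZero c] (x : V → ℝ) (s : Finset V) (y : V → Fin c) : 𝔼 b, linForm x s b y = 0 := by
  unfold linForm
  rw [Finset.expect_sum_comm]
  simp_rw [← Finset.mul_expect, expect_matchKernel]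
  simp

variable [Fintype V] [LinearOrder V]

/-- The part of the quadratic form with coefficients `a i k`, `i < k`, whose larger index
lies in `s`. -/
noncomputable def quadForm (a : V → V → ℝ) (s : Finset V) (y : V → Fin c) : ℝ :=
  ∑ k ∈ s, linForm (fun i => a i k) {i | i < k} (y k) y

lemma quadForm_update_of_lt {a : V → V → ℝ} {s : Finset V} {k : V} (hk : ∀ j ∈ s, j < k)
    (b : Fin c) (y : V → Fin c) : quadForm a s (Function.update y k b) = quadForm a s y := by
  refine Finset.sum_congr rfl fun j hj => ?_
  rw [Function.update_of_ne (hk j hj).ne, linForm_update_of_notMem]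
  simpa using (hk j hj).le

variable [NeZero c]

lemma expect_linForm_pow_six_le (x : V → ℝ) (s : Finset V) (b : Fin c) :
    𝔼 y, linForm x s b y ^ 6 ≤ (10 * ∑ i ∈ s, x i ^ 2) ^ 3 := by
  induction s using Finset.induction_on with
  | empty => simp [linForm]
  | insert k s hk ih =>
    have h := expect_add_pow_six_le k (X := linForm x s b)
      (Y := fun y : V → Fin c => x k * matchKernel (y k) b) (A := 10 * ∑ i ∈ s, x i ^ 2)
      (B := x k ^ 2) (by positivity) (by positivity) (fun y b' => linForm_update_of_notMem hk b b' y)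
      (fun y => by simp [← Finset.mul_expect, expect_matchKernel_left]) ih (by
        calc 𝔼 y : V → Fin c, (x k * matchKernel (y k) b) ^ 6
            ≤ 𝔼 y : V → Fin c, (x k ^ 2) ^ 3 := by
              refine Finset.expect_le_expect fun y _ => ?_
              rw [mul_pow, ← pow_mul, show 2 * 3 = 6 from rfl]
              have h6 : matchKernel (y k) b ^ 6 ≤ 1 := by
                rw [← Even.pow_abs (by decide : Even 6)]
                exact pow_le_one₀ (abs_nonneg _) (abs_matchKernel_le_one _ _)
              have : 0 ≤ x k ^ 6 := by positivity
              nlinarith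
          _ = (x k ^ 2) ^ 3 := by simp)
    rw [Finset.sum_insert hk]
    convert h using 3
    · rw [linForm, Finset.sum_insert hk, linForm, add_comm]
    · ring

/-- The form does not involve the color of k, so that color may be averaged independently. -/
lemma expect_expect_linForm (F : ℝ → ℝ) (x : V → ℝ) {s : Finset V} {k : V} (hk : k ∉ s) :
    𝔼 y : V → Fin c, F (linForm x s (y k) y) = 𝔼 b : Fin c, 𝔼 y, F (linForm x s b y) := by
  rw [← expect_expect_update k, Finset.expect_comm]
  simp [linForm_update_of_notMem hk]

/-- Induction on the largest index: given its own color, the new increment is a linear form, with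
constant 10 in its sixth moment. The martingale step contributes another factor 10. -/
lemma expect_quadForm_pow_six_le (a : V → V → ℝ) (s : Finset V) :
    𝔼 y : V → Fin c, quadForm a s y ^ 6 ≤ (100 * ∑ k ∈ s, ∑ i with i < k, a i k ^ 2) ^ 3 := by
  induction s using Finset.induction_on_max with
  | empty => simp [quadForm]
  | insert k s hk ih =>
    have hks : k ∉ s := fun h => lt_irrefl _ (hk k h)
    have h := expect_add_pow_six_le k (X := quadForm (c := c) a s)
      (Y := fun y => linForm (fun i => a i k) {i | i < k} (y k) y)
      (A := 100 * ∑ k ∈ s, ∑ i with i < k, a i k ^ 2) (B := 10 * ∑ i with i < k, a i k ^ 2)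
      (by positivity) (by positivity) (fun y b => quadForm_update_of_lt hk b y)
      (fun y => by
        simp only [Function.update_self]
        rw [← expect_linForm (fun i => a i k) {i | i < k} y]
        refine Finset.expect_congr rfl fun b _ => linForm_update_of_notMem (by simp) _ _ _) ih (by
        rw [expect_expect_linForm (fun z => z ^ 6) _ (by simp)]
        exact Finset.expect_le Finset.univ_nonempty fun b _ => expect_linForm_pow_six_le _ _ b)
    rw [Finset.sum_insert hks]
    convert h using 3
    · rw [quadForm, Finset.sum_insert hks, quadForm, add_comm]
    · ring

end Forms

/-! ### Taylor bounds for the complex exponential. -/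

section ExpBounds

open Complex

lemma ofReal_expect {ι : Type*} [Fintype ι] (f : ι → ℝ) :
    ((𝔼 i, f i : ℝ) : ℂ) = 𝔼 i, (f i : ℂ) :=
  algebraMap.coe_expect Finset.univ f (N := ℂ)

lemma norm_expect_le_expect_norm {ι : Type*} [Fintype ι] (f : ι → ℂ) :
    ‖𝔼 i, f i‖ ≤ 𝔼 i, ‖f i‖ := by
  rw [Fintype.expect_eq_sum_div_card, Fintype.expect_eq_sum_div_card, norm_div]
  simp only [Complex.norm_natCast]
  gcongr
  exact norm_sum_le _ _

lemma norm_exp_I_mul_sub_one_sub_le (x : ℝ) : ‖exp (I * x) - 1 - I * x‖ ≤ 3 * x ^ 2 := by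
  have hn : ‖I * (x : ℂ)‖ = |x| := by simp
  rw [← sq_abs]
  rcases le_total |x| 1 with h | h
  · have h1 := norm_exp_sub_one_sub_id_le (x := I * x) (by rw [hn]; exact h)
    rw [hn] at h1
    nlinarith [sq_nonneg |x|]
  · calc ‖exp (I * x) - 1 - I * x‖ ≤ ‖exp (I * x)‖ + ‖(1 : ℂ)‖ + ‖I * (x : ℂ)‖ :=
          (norm_sub_le _ _).trans (by gcongr; exact norm_sub_le _ _)
      _ = 1 + 1 + |x| := by rw [norm_exp_I_mul_ofReal, hn, norm_one]
      _ ≤ 3 * |x| ^ 2 := by nlinarith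

lemma norm_exp_I_mul_sub_one_sub_add_le (x : ℝ) :
    ‖exp (I * x) - 1 - I * x + x ^ 2 / 2‖ ≤ 5 * |x| ^ 3 := by
  have hn : ‖I * (x : ℂ)‖ = |x| := by simp
  rcases le_total |x| 1 with h | h
  · have h1 := exp_bound (x := I * x) (by rw [hn]; exact h) (n := 3) (by norm_num)
    rw [hn] at h1
    have e : exp (I * x) - ∑ m ∈ Finset.range 3, (I * (x : ℂ)) ^ m / (m.factorial : ℂ) =
        exp (I * x) - 1 - I * x + x ^ 2 / 2 := by
      simp [Finset.sum_range_succ, mul_pow]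
      ring
    rw [e] at h1
    refine h1.trans ?_
    norm_num [Nat.factorial]
    have : 0 ≤ |x| ^ 3 := by positivity
    linarith
  · have h2 : ‖(x : ℂ) ^ 2 / 2‖ = |x| ^ 2 / 2 := by simp
    calc ‖exp (I * x) - 1 - I * x + x ^ 2 / 2‖
        ≤ ‖exp (I * x) - 1 - I * x‖ + ‖(x : ℂ) ^ 2 / 2‖ := norm_add_le _ _
      _ ≤ 3 * x ^ 2 + |x| ^ 2 / 2 := by rw [h2]; gcongr; exact norm_exp_I_mul_sub_one_sub_le x
      _ ≤ 5 * |x| ^ 3 := by rw [← sq_abs x]; nlinarith [sq_nonneg |x|]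

lemma exp_sub_one_le_mul_exp {x : ℝ} : Real.exp x - 1 ≤ x * Real.exp x := by
  have h := Real.add_one_le_exp (-x)
  have h2 : Real.exp (-x) * Real.exp x = 1 := by rw [← Real.exp_add]; simp
  nlinarith [Real.exp_pos x]

lemma exp_sub_one_sub_le_sq_mul_exp {x : ℝ} (hx : 0 ≤ x) :
    Real.exp x - 1 - x ≤ x ^ 2 * Real.exp x := by
  have h := exp_sub_one_le_mul_exp (x := x)
  have := mul_le_mul_of_nonneg_left h hx
  nlinarith

/-- The error of one step of the martingale argument, where `φ` is the conditional characteristic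
function of the increment, `v + β` its conditional variance, `v` the mean of the latter and `B` the
cumulative fluctuation of the conditional variances. -/
lemma norm_tilted_step_le {φ : ℂ} {v β B T : ℝ} (hv : 0 ≤ v) (hV : 0 ≤ v + β)
    (h3 : ‖φ - 1 + ((v + β : ℝ) : ℂ) / 2‖ ≤ 5 * T) (h2 : ‖φ - 1‖ ≤ 3 * (v + β)) :
    ‖φ * Real.exp (v / 2) * (1 + (B : ℂ) / 2) - (1 + ((B - β : ℝ) : ℂ) / 2)‖ ≤
      Real.exp (v / 2) * (5 * T + v ^ 2 / 4 + (v + β) * v / 4 +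
        (3 * (v + β) + v / 2) * |B| / 2) := by
  set e := Real.exp (v / 2) with he
  have he0 : 0 < e := Real.exp_pos _
  have he1 : 1 ≤ e := Real.one_le_exp (by positivity)
  have b1 : e - 1 ≤ v / 2 * e := exp_sub_one_le_mul_exp
  have b2 : e - 1 - v / 2 ≤ (v / 2) ^ 2 * e := exp_sub_one_sub_le_sq_mul_exp (by positivity)
  have b3 : 0 ≤ e - 1 - v / 2 := by linarith [Real.add_one_le_exp (v / 2)]
  -- The first-order terms ±v/2 and ±β/2 cancel; each remaining summand is a Taylor remainder or a
  -- product of two small quantities.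
  have heq : φ * e * (1 + (B : ℂ) / 2) - (1 + ((B - β : ℝ) : ℂ) / 2) =
      (φ - 1 + ((v + β : ℝ) : ℂ) / 2) * (e : ℂ) + ((e - 1 - v / 2 : ℝ) : ℂ)
        - (((v + β) / 2 * (e - 1) : ℝ) : ℂ)
        + ((φ - 1) * (e : ℂ) + ((e - 1 : ℝ) : ℂ)) * ((B / 2 : ℝ) : ℂ) := by
    push_cast
    ring
  rw [heq]
  have n1 : ‖(φ - 1 + ((v + β : ℝ) : ℂ) / 2) * (e : ℂ)‖ ≤ 5 * T * e := by
    rw [norm_mul, norm_real, Real.norm_of_nonneg he0.le]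
    gcongr
  have n2 : ‖((e - 1 - v / 2 : ℝ) : ℂ)‖ ≤ (v / 2) ^ 2 * e := by
    rw [norm_real, Real.norm_of_nonneg b3]; exact b2
  have n3 : ‖(((v + β) / 2 * (e - 1) : ℝ) : ℂ)‖ ≤ (v + β) / 2 * (v / 2 * e) := by
    rw [norm_real, Real.norm_of_nonneg (mul_nonneg (by positivity) (by linarith))]
    gcongr
  have n4 : ‖((φ - 1) * (e : ℂ) + ((e - 1 : ℝ) : ℂ)) * ((B / 2 : ℝ) : ℂ)‖ ≤
      (3 * (v + β) * e + v / 2 * e) * (|B| / 2) := by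
    rw [norm_mul, norm_real, Real.norm_eq_abs, abs_div, abs_two]
    gcongr
    refine (norm_add_le _ _).trans ?_
    rw [norm_mul, norm_real, norm_real, Real.norm_of_nonneg he0.le,
      Real.norm_of_nonneg (by linarith : 0 ≤ e - 1)]
    gcongr
  calc _ ≤ 5 * T * e + (v / 2) ^ 2 * e + (v + β) / 2 * (v / 2 * e)
        + (3 * (v + β) * e + v / 2 * e) * (|B| / 2) :=
        (norm_add_le _ _).trans (add_le_add ((norm_sub_le _ _).trans
          (add_le_add ((norm_add_le _ _).trans (add_le_add n1 n2)) n3)) n4)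
    _ = _ := by ring

end ExpBounds

/-! ### Cauchy–Schwarz for averages. -/

section CauchySchwarz

variable {ι : Type*} [Fintype ι]

lemma expect_mul_le_of_sq_le {X Y : ι → ℝ} {A B : ℝ} (hA : 0 ≤ A) (hB : 0 ≤ B)
    (hX : 𝔼 y, X y ^ 2 ≤ A ^ 2) (hY : 𝔼 y, Y y ^ 2 ≤ B ^ 2) : 𝔼 y, X y * Y y ≤ A * B := by
  refine le_of_abs_le (abs_le_of_sq_le_sq ?_ (mul_nonneg hA hB))
  calc (𝔼 y, X y * Y y) ^ 2 ≤ (𝔼 y, X y ^ 2) * 𝔼 y, Y y ^ 2 :=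
        Finset.expect_mul_sq_le_sq_mul_sq _ _ _
    _ ≤ A ^ 2 * B ^ 2 := by
        gcongr
    _ = (A * B) ^ 2 := by ring

lemma expect_abs_le_of_sq_le [Nonempty ι] {X : ι → ℝ} {A : ℝ} (hA : 0 ≤ A)
    (hX : 𝔼 y, X y ^ 2 ≤ A ^ 2) : 𝔼 y, |X y| ≤ A := by
  have h := expect_mul_le_of_sq_le (X := fun y => |X y|) (Y := fun _ => 1) (B := 1) hA zero_le_one
    (by simpa using hX) (by simp)
  simpa using h

end CauchySchwarz

/-! ### Conditional variances of the increments. -/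

section ConditionalVariance

variable {V : Type*} [Fintype V] [LinearOrder V]

lemma sum_sum_eq_diag_add_two_mul {f : V → V → ℝ} (hf : ∀ i j, f i j = f j i) :
    ∑ i, ∑ j, f i j = ∑ i, f i i + 2 * ∑ j, ∑ i with i < j, f i j := by
  have h : ∀ j, ∑ i, f i j = f j j + (∑ i with i < j, f i j + ∑ i with j < i, f i j) := by
    intro j
    rw [Finset.sum_filter, Finset.sum_filter, ← Finset.sum_add_distrib,
      ← Finset.add_sum_erase _ _ (Finset.mem_univ j),
      ← Finset.add_sum_erase _ (fun i => _ + _) (Finset.mem_univ j)]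
    simp only [lt_irrefl, if_false, add_zero, zero_add]
    congr 1
    refine Finset.sum_congr rfl fun i hi => ?_
    rcases lt_or_gt_of_ne (Finset.ne_of_mem_erase hi) with h | h
    · simp [h, h.le]
    · simp [h, h.le]
  rw [Finset.sum_comm]
  simp_rw [h, Finset.sum_add_distrib]
  have e : ∑ j, ∑ i with j < i, f i j = ∑ j, ∑ i with i < j, f i j := by
    simp_rw [Finset.sum_filter]
    rw [Finset.sum_comm]
    refine Finset.sum_congr rfl fun i _ => Finset.sum_congr rfl fun j _ => ?_
    rw [hf]
  rw [e]
  ring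

variable (c : ℕ)

/-- The coefficients of the quadratic form that is the fluctuation of the sum over `k ∈ s` of the
conditional variances of the increments of `quadForm a`. -/
noncomputable def varCoeff (a : V → V → ℝ) (s : Finset V) (i j : V) : ℝ :=
  2 / (c : ℝ) * ∑ k ∈ s with j < k, a i k * a j k

/-- The variance of the `k`-th increment of `quadForm a`. -/
noncomputable def incrVar (a : V → V → ℝ) (k : V) : ℝ :=
  1 / (c : ℝ) * (1 - 1 / c) * ∑ i with i < k, a i k ^ 2

variable {c}

lemma quadForm_varCoeff_insert {a : V → V → ℝ} {s : Finset V} {k : V} (hk : k ∉ s)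
    (y : V → Fin c) : quadForm (varCoeff c a (insert k s)) Finset.univ y =
      quadForm (varCoeff c a s) Finset.univ y + quadForm (varCoeff c a {k}) Finset.univ y := by
  simp_rw [quadForm, linForm, ← Finset.sum_add_distrib]
  refine Finset.sum_congr rfl fun j _ => Finset.sum_congr rfl fun i _ => ?_
  have : varCoeff c a (insert k s) i j = varCoeff c a s i j + varCoeff c a {k} i j := by
    simp_rw [varCoeff, Finset.sum_filter]
    rw [Finset.sum_insert hk, Finset.sum_singleton]
    ring
  rw [this]
  ring

/-- Predictability: a pair i < j has a nonzero coefficient only if j lies below some element of s,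
so colors from the maximum of s on never enter. -/
lemma quadForm_varCoeff_update {a : V → V → ℝ} {s : Finset V} {k : V} (hk : ∀ j ∈ s, j ≤ k)
    (b : Fin c) (y : V → Fin c) : quadForm (varCoeff c a s) Finset.univ (Function.update y k b) =
      quadForm (varCoeff c a s) Finset.univ y := by
  refine Finset.sum_congr rfl fun j _ => Finset.sum_congr rfl fun i hi => ?_
  have hij : i < j := by simpa using hi
  rcases lt_or_ge j k with hjk | hjk
  · rw [Function.update_of_ne hjk.ne, Function.update_of_ne (hij.trans hjk).ne]
  · have : varCoeff c a s i j = 0 := by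
      rw [varCoeff, Finset.filter_false_of_mem, Finset.sum_empty, mul_zero]
      exact fun l hl => not_lt.2 ((hk l hl).trans hjk)
    simp [this]

/-- Expanding the square and composing kernels turns each product into a single kernel in y i and y
j. The diagonal gives the constant variance; the off-diagonal part is again a quadratic form, to
which the sixth-moment bound applies. -/
lemma expect_linForm_sq [NeZero c] (a : V → V → ℝ) (k : V) (y : V → Fin c) :
    𝔼 b, linForm (fun i => a i k) {i | i < k} b y ^ 2 =
      incrVar c a k + quadForm (varCoeff c a {k}) Finset.univ y := by
  have hc : (c : ℝ) ≠ 0 := by exact_mod_cast NeZero.ne c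
  set x : V → ℝ := fun i => if i < k then a i k else 0 with hx
  have h1 : ∀ b, linForm (fun i => a i k) {i | i < k} b y = ∑ i, x i * matchKernel (y i) b := by
    intro b
    rw [linForm, Finset.sum_filter]
    refine Finset.sum_congr rfl fun i _ => ?_
    by_cases h : i < k <;> simp [hx, h]
  have h2 : 𝔼 b, linForm (fun i => a i k) {i | i < k} b y ^ 2 =
      ∑ i, ∑ j, x i * x j * (matchKernel (y i) (y j) / c) := by
    simp_rw [h1, sq, Finset.sum_mul_sum, Finset.expect_sum_comm]
    refine Finset.sum_congr rfl fun i _ => Finset.sum_congr rfl fun j _ => ?_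
    rw [← expect_matchKernel_mul, Finset.mul_expect]
    exact Finset.expect_congr rfl fun b _ => by ring
  rw [h2, sum_sum_eq_diag_add_two_mul fun i j => by rw [matchKernel_comm]; ring]
  congr 1
  · rw [incrVar, Finset.sum_filter, Finset.mul_sum]
    refine Finset.sum_congr rfl fun i _ => ?_
    rw [matchKernel_self]
    by_cases h : i < k <;> simp [hx, h]
    ring
  · rw [quadForm, Finset.mul_sum]
    refine Finset.sum_congr rfl fun j _ => ?_
    rw [linForm, Finset.mul_sum]
    refine Finset.sum_congr rfl fun i hi => ?_
    have hij : i < j := by simpa using hi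
    rw [varCoeff, Finset.sum_filter, Finset.sum_singleton]
    by_cases h : j < k
    · simp only [hx, h, hij.trans h, if_true]
      ring
    · simp [hx, h]

lemma incrVar_nonneg [NeZero c] (a : V → V → ℝ) (k : V) : 0 ≤ incrVar c a k := by
  have hc : (1 : ℝ) ≤ c := by exact_mod_cast NeZero.one_le
  have h1 : 1 / (c : ℝ) ≤ 1 := by rw [div_le_one (by positivity)]; exact hc
  have : 0 ≤ 1 - 1 / (c : ℝ) := by linarith
  unfold incrVar
  positivity

lemma incrVar_le [NeZero c] (a : V → V → ℝ) (k : V) :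
    incrVar c a k ≤ ∑ i with i < k, a i k ^ 2 := by
  have hc : (1 : ℝ) ≤ c := by exact_mod_cast NeZero.one_le
  have h1 : 1 / (c : ℝ) ≤ 1 := by rw [div_le_one (by positivity)]; exact hc
  have h0 : 0 ≤ 1 / (c : ℝ) := by positivity
  have : 1 / (c : ℝ) * (1 - 1 / c) ≤ 1 := by nlinarith
  exact mul_le_of_le_one_left (Finset.sum_nonneg fun _ _ => sq_nonneg _) this

lemma sum_varCoeff_singleton_sq_le [NeZero c] (a : V → V → ℝ) (k : V) :
    ∑ j, ∑ i with i < j, varCoeff c a {k} i j ^ 2 ≤ 4 * (∑ i with i < k, a i k ^ 2) ^ 2 := by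
  have hc : (1 : ℝ) ≤ c := by exact_mod_cast NeZero.one_le
  have h2 : (2 / (c : ℝ)) ^ 2 ≤ 4 := by
    have : 2 / (c : ℝ) ≤ 2 := by rw [div_le_iff₀ (by positivity)]; linarith
    have : 0 ≤ 2 / (c : ℝ) := by positivity
    nlinarith
  calc ∑ j, ∑ i with i < j, varCoeff c a {k} i j ^ 2
      ≤ ∑ j with j < k, ∑ i with i < k, 4 * (a i k ^ 2 * a j k ^ 2) := by
        rw [Finset.sum_filter]
        refine Finset.sum_le_sum fun j _ => ?_
        split_ifs with h
        · calc ∑ i with i < j, varCoeff c a {k} i j ^ 2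
              ≤ ∑ i with i < j, 4 * (a i k ^ 2 * a j k ^ 2) := by
                refine Finset.sum_le_sum fun i _ => ?_
                rw [varCoeff, Finset.sum_filter, Finset.sum_singleton, if_pos h, mul_pow, mul_pow]
                gcongr
            _ ≤ _ := by
                refine Finset.sum_le_sum_of_subset_of_nonneg ?_ fun _ _ _ => by positivity
                exact Finset.monotone_filter_right _ fun i _ hi => lt_trans hi h
        · refine (Finset.sum_eq_zero fun i _ => ?_).le
          rw [varCoeff, Finset.sum_filter, Finset.sum_singleton, if_neg h]
          simp
    _ = 4 * (∑ i with i < k, a i k ^ 2) ^ 2 := by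
        rw [sq, Finset.sum_mul_sum, Finset.mul_sum]
        refine Finset.sum_congr rfl fun j _ => ?_
        rw [Finset.mul_sum]
        exact Finset.sum_congr rfl fun i _ => by ring

end ConditionalVariance

/-! ### The martingale central limit theorem. -/

section CharacteristicFunction

open Complex

variable {V : Type*} [Fintype V] [LinearOrder V] {c : ℕ} [NeZero c]

lemma expect_quadForm_varCoeff_sq_le (a : V → V → ℝ) (s : Finset V) :
    𝔼 y : V → Fin c, quadForm (varCoeff c a s) Finset.univ y ^ 2 ≤
      100 * ∑ j, ∑ i with i < j, varCoeff c a s i j ^ 2 :=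
  expect_sq_le_of_pow_six (by positivity) (expect_quadForm_pow_six_le _ _)

lemma expect_abs_linForm_pow_three_le {x : V → ℝ} {s : Finset V} {κ : ℝ} (hκ : 0 ≤ κ)
    (hx : ∑ i ∈ s, x i ^ 2 ≤ κ ^ 2) (b : Fin c) :
    𝔼 y, |linForm x s b y| ^ 3 ≤ 32 * κ * ∑ i ∈ s, x i ^ 2 := by
  set w := ∑ i ∈ s, x i ^ 2 with hw
  have hw0 : 0 ≤ w := Finset.sum_nonneg fun _ _ => sq_nonneg _
  have h := expect_abs_le_of_sq_le (X := fun y => |linForm x s b y| ^ 3) (A := 32 * κ * w)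
    (by positivity) (by
      calc 𝔼 y, (|linForm x s b y| ^ 3) ^ 2 = 𝔼 y, linForm x s b y ^ 6 :=
            Finset.expect_congr rfl fun y _ => by
              rw [← pow_mul, Even.pow_abs (by decide : Even (3 * 2))]
        _ ≤ (10 * w) ^ 3 := expect_linForm_pow_six_le x s b
        -- Uses w ≤ κ² and 10³ ≤ 32².
        _ ≤ (32 * κ * w) ^ 2 := by nlinarith [sq_nonneg w])
  simpa using h

/-- The quantity whose average is almost preserved by adding a martingale increment: the
normalized complex exponential with a first order correction for the conditional variance. -/
noncomputable def tiltedExp (a : V → V → ℝ) (s : Finset V) (y : V → Fin c) : ℂ :=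
  exp (I * quadForm a s y) * Real.exp (∑ k ∈ s, incrVar c a k / 2) *
    (1 + (quadForm (varCoeff c a s) Finset.univ y : ℂ) / 2)

/-- By predictability the correction factor for the enlarged set does not depend on the color of k;
only the exponential of the new increment is averaged over it. -/
lemma expect_tiltedExp_insert {a : V → V → ℝ} {s : Finset V} {k : V} (hk : ∀ j ∈ s, j < k) :
    𝔼 y : V → Fin c, tiltedExp a (insert k s) y =
      𝔼 y : V → Fin c, exp (I * quadForm a s y) * Real.exp (∑ k ∈ s, incrVar c a k / 2) *
        ((𝔼 b, exp (I * linForm (fun i => a i k) {i | i < k} b y)) * Real.exp (incrVar c a k / 2) *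
        (1 + (quadForm (varCoeff c a (insert k s)) Finset.univ y : ℂ) / 2)) := by
  have hks : k ∉ s := fun h => lt_irrefl _ (hk k h)
  rw [← expect_expect_update k]
  refine Finset.expect_congr rfl fun y _ => ?_
  have h1 : ∀ b, tiltedExp a (insert k s) (Function.update y k b) =
      exp (I * quadForm a s y) * Real.exp (∑ k ∈ s, incrVar c a k / 2) *
        (exp (I * linForm (fun i => a i k) {i | i < k} b y) * Real.exp (incrVar c a k / 2) *
        (1 + (quadForm (varCoeff c a (insert k s)) Finset.univ y : ℂ) / 2)) := by
    intro b
    have h2 : quadForm a (insert k s) (Function.update y k b) =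
        linForm (fun i => a i k) {i | i < k} b y + quadForm a s y := by
      conv_rhs => rw [← quadForm_update_of_lt hk b y]
      rw [quadForm, Finset.sum_insert hks, Function.update_self,
        linForm_update_of_notMem (by simp), quadForm]
    have h3 : exp (I * ((linForm (fun i => a i k) {i | i < k} b y + quadForm a s y : ℝ) : ℂ)) =
        exp (I * linForm (fun i => a i k) {i | i < k} b y) * exp (I * quadForm a s y) := by
      rw [← exp_add, ofReal_add, mul_add]
    rw [tiltedExp, h2, h3, Finset.sum_insert hks, Real.exp_add, quadForm_varCoeff_update (by
      simpa using fun j hj => (hk j hj).le)]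
    push_cast
    ring
  simp_rw [h1]
  rw [← Finset.mul_expect, ← Finset.expect_mul, ← Finset.expect_mul]

lemma norm_expect_exp_linForm_bounds (a : V → V → ℝ) (k : V) (y : V → Fin c) :
    ‖𝔼 b, exp (I * linForm (fun i => a i k) {i | i < k} b y) - 1 +
        ((incrVar c a k + quadForm (varCoeff c a {k}) Finset.univ y : ℝ) : ℂ) / 2‖ ≤
      5 * 𝔼 b, |linForm (fun i => a i k) {i | i < k} b y| ^ 3 ∧
    ‖𝔼 b, exp (I * linForm (fun i => a i k) {i | i < k} b y) - 1‖ ≤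
      3 * (incrVar c a k + quadForm (varCoeff c a {k}) Finset.univ y) := by
  set L : Fin c → ℝ := fun b => linForm (fun i => a i k) {i | i < k} b y with hL
  have h0 : 𝔼 b, (L b : ℂ) = 0 := by
    rw [← ofReal_expect, expect_linForm, ofReal_zero]
  rw [← expect_linForm_sq]
  constructor
  · have e : 𝔼 b, exp (I * L b) - 1 + ((𝔼 b, L b ^ 2 : ℝ) : ℂ) / 2 =
        𝔼 b, (exp (I * L b) - 1 - I * L b + (L b : ℂ) ^ 2 / 2) := by
      rw [Finset.expect_add_distrib, Finset.expect_sub_distrib, Finset.expect_sub_distrib,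
        ← Finset.mul_expect, h0, ← Finset.expect_div]
      simp
    rw [e, Finset.mul_expect]
    exact (norm_expect_le_expect_norm _).trans (Finset.expect_le_expect fun b _ =>
      norm_exp_I_mul_sub_one_sub_add_le _)
  · have e : 𝔼 b, exp (I * L b) - 1 = 𝔼 b, (exp (I * L b) - 1 - I * L b) := by
      rw [Finset.expect_sub_distrib, Finset.expect_sub_distrib, ← Finset.mul_expect, h0]
      simp
    rw [e, Finset.mul_expect]
    exact (norm_expect_le_expect_norm _).trans (Finset.expect_le_expect fun b _ =>
      norm_exp_I_mul_sub_one_sub_le _)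

section Bounds

variable {a : V → V → ℝ} {κ η : ℝ}

/-- The linear correction in `tiltedExp` cancels the random part of the conditional variance to
first order. What remains is third moments and products of small terms, so the error is a small
factor times the weight of row k and can be summed over k. -/
lemma norm_expect_tiltedExp_insert_sub_le (hκ : 0 ≤ κ) (hη : 0 ≤ η) {s : Finset V} {k : V}
    (hk : ∀ j ∈ s, j < k) (hw : ∑ i with i < k, a i k ^ 2 ≤ κ ^ 2)
    (hB : 100 * ∑ j, ∑ i with i < j, varCoeff c a (insert k s) i j ^ 2 ≤ η ^ 2) :
    ‖𝔼 y : V → Fin c, tiltedExp a (insert k s) y - 𝔼 y : V → Fin c, tiltedExp a s y‖ ≤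
      Real.exp (∑ j ∈ insert k s, incrVar c a j / 2) *
        ((160 * κ + 6 * κ ^ 2 + 32 * η) * ∑ i with i < k, a i k ^ 2) := by
  have hks : k ∉ s := fun h => lt_irrefl _ (hk k h)
  set w := ∑ i with i < k, a i k ^ 2 with hwdef
  set v := incrVar c a k with hv
  set B : (V → Fin c) → ℝ := quadForm (varCoeff c a (insert k s)) Finset.univ with hBdef
  set β : (V → Fin c) → ℝ := quadForm (varCoeff c a {k}) Finset.univ with hβdef
  set T : (V → Fin c) → ℝ :=
    fun y => 𝔼 b, |linForm (fun i => a i k) {i | i < k} b y| ^ 3 with hTdef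
  have hw0 : 0 ≤ w := Finset.sum_nonneg fun _ _ => sq_nonneg _
  have hv0 : 0 ≤ v := incrVar_nonneg a k
  have hvw : v ≤ w := incrVar_le a k
  have hvβ : ∀ y, 0 ≤ v + β y := fun y => by
    rw [← expect_linForm_sq]
    exact Finset.expect_nonneg fun _ _ => sq_nonneg _
  have hβ2 : 𝔼 y, β y ^ 2 ≤ (20 * w) ^ 2 := (expect_quadForm_varCoeff_sq_le a {k}).trans (by
    have := sum_varCoeff_singleton_sq_le (c := c) a k
    rw [← hwdef] at this
    linarith)
  have hB2 : 𝔼 y, B y ^ 2 ≤ η ^ 2 := (expect_quadForm_varCoeff_sq_le a _).trans hB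
  have eT : 𝔼 y, T y ≤ 32 * κ * w := by
    rw [hTdef, Finset.expect_comm]
    exact Finset.expect_le Finset.univ_nonempty fun b _ => expect_abs_linForm_pow_three_le hκ hw b
  have eβ : 𝔼 y, |β y| ≤ 20 * w := expect_abs_le_of_sq_le (by positivity) hβ2
  have eB : 𝔼 y, |B y| ≤ η := expect_abs_le_of_sq_le hη hB2
  have eβB : 𝔼 y, |β y| * |B y| ≤ 20 * w * η :=
    expect_mul_le_of_sq_le (by positivity) hη (by simpa using hβ2) (by simpa using hB2)
  set e := Real.exp (∑ j ∈ s, incrVar c a j / 2) with he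
  have he0 : 0 ≤ e := (Real.exp_pos _).le
  have hpt : ∀ y : V → Fin c,
      ‖exp (I * quadForm a s y) * (e : ℂ) *
        ((𝔼 b, exp (I * linForm (fun i => a i k) {i | i < k} b y)) * Real.exp (v / 2) *
        (1 + (B y : ℂ) / 2)) - tiltedExp a s y‖ ≤
      e * (Real.exp (v / 2) * (5 * T y + v ^ 2 / 2 + v / 4 * |β y| + 3 / 2 * (|β y| * |B y|)
        + 7 / 4 * v * |B y|)) := by
    intro y
    have hBs : quadForm (varCoeff c a s) Finset.univ y = B y - β y := by
      rw [hBdef, quadForm_varCoeff_insert hks, hβdef]; ring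
    obtain ⟨h3, h2⟩ := norm_expect_exp_linForm_bounds (c := c) a k y
    have h := norm_tilted_step_le (B := B y) hv0 (hvβ y) h3 h2
    rw [tiltedExp, hBs, ← mul_sub, norm_mul, norm_mul, norm_exp_I_mul_ofReal, one_mul, norm_real,
      Real.norm_of_nonneg he0]
    refine mul_le_mul_of_nonneg_left (h.trans ?_) he0
    refine mul_le_mul_of_nonneg_left ?_ (Real.exp_pos _).le
    have hb := le_abs_self (β y)
    have := mul_le_mul_of_nonneg_left hb hv0
    have := mul_le_mul_of_nonneg_right hb (abs_nonneg (B y))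
    change 5 * T y + v ^ 2 / 4 + (v + β y) * v / 4 + (3 * (v + β y) + v / 2) * |B y| / 2 ≤ _
    nlinarith
  have hvκ : v * v ≤ κ ^ 2 * w := mul_le_mul (hvw.trans hw) hvw hv0 (sq_nonneg _)
  calc ‖𝔼 y : V → Fin c, tiltedExp a (insert k s) y - 𝔼 y : V → Fin c, tiltedExp a s y‖
      ≤ 𝔼 y : V → Fin c, e * (Real.exp (v / 2) * (5 * T y + v ^ 2 / 2 + v / 4 * |β y|
        + 3 / 2 * (|β y| * |B y|) + 7 / 4 * v * |B y|)) := by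
        rw [expect_tiltedExp_insert hk, ← Finset.expect_sub_distrib]
        exact (norm_expect_le_expect_norm _).trans (Finset.expect_le_expect fun y _ => hpt y)
    _ = e * Real.exp (v / 2) * (5 * 𝔼 y, T y + v ^ 2 / 2 + v / 4 * 𝔼 y, |β y|
        + 3 / 2 * 𝔼 y, |β y| * |B y| + 7 / 4 * v * 𝔼 y, |B y|) := by
        simp only [← Finset.mul_expect, Finset.expect_add_distrib, Fintype.expect_const]
        ring
    -- The constants are 160 = 5·32, 6 ≥ 1/2 + 20/4 and 32 ≥ (3/2)·20 + 7/4.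
    _ ≤ e * Real.exp (v / 2) * ((160 * κ + 6 * κ ^ 2 + 32 * η) * w) := by
        gcongr
        have h1 : v / 4 * 𝔼 y, |β y| ≤ κ ^ 2 / 4 * (20 * w) :=
          mul_le_mul (by linarith [hvw.trans hw]) eβ
            (Finset.expect_nonneg fun _ _ => abs_nonneg _) (by positivity)
        have h2 : 7 / 4 * v * 𝔼 y, |B y| ≤ 7 / 4 * w * η :=
          mul_le_mul (by linarith) eB (Finset.expect_nonneg fun _ _ => abs_nonneg _) (by positivity)
        have : 0 ≤ κ ^ 2 * w := by positivity
        have : 0 ≤ w * η := by positivity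
        nlinarith
    _ = _ := by
        rw [Finset.sum_insert hks, Real.exp_add, mul_comm e]

/-- A quantitative martingale central limit theorem for quadratic forms in the colors. -/
lemma norm_expect_exp_quadForm_sub_le (hκ : 0 ≤ κ) (hη : 0 ≤ η)
    (hw : ∀ k, ∑ i with i < k, a i k ^ 2 ≤ κ ^ 2)
    (hB : ∀ s, 100 * ∑ j, ∑ i with i < j, varCoeff c a s i j ^ 2 ≤ η ^ 2) :
    ‖𝔼 y : V → Fin c, exp (I * quadForm a Finset.univ y) -
        Real.exp (-∑ k, incrVar c a k / 2)‖ ≤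
      Real.exp (∑ k, incrVar c a k / 2) *
        ((160 * κ + 6 * κ ^ 2 + 32 * η) * ∑ k, ∑ i with i < k, a i k ^ 2 + η) := by
  set e := Real.exp (∑ k, incrVar c a k / 2) with he
  set D := 160 * κ + 6 * κ ^ 2 + 32 * η with hD
  have hD0 : 0 ≤ D := by positivity
  have he0 : 0 ≤ e := (Real.exp_pos _).le
  have main : ∀ s : Finset V, ‖𝔼 y : V → Fin c, tiltedExp a s y - 1‖ ≤
      e * (D * ∑ k ∈ s, ∑ i with i < k, a i k ^ 2) := by
    intro s
    induction s using Finset.induction_on_max with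
    | empty => simp [tiltedExp, quadForm, linForm, varCoeff]
    | insert k s hk ih =>
      have h := norm_expect_tiltedExp_insert_sub_le hκ hη hk (hw k) (hB (insert k s))
      have hle : Real.exp (∑ j ∈ insert k s, incrVar c a j / 2) ≤ e := by
        refine Real.exp_le_exp.2 (Finset.sum_le_sum_of_subset_of_nonneg (Finset.subset_univ _) ?_)
        exact fun j _ _ => div_nonneg (incrVar_nonneg a j) two_pos.le
      rw [Finset.sum_insert fun h => lt_irrefl _ (hk k h)]
      calc _ ≤ ‖𝔼 y : V → Fin c, tiltedExp a (insert k s) y - 𝔼 y : V → Fin c, tiltedExp a s y‖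
            + ‖𝔼 y : V → Fin c, tiltedExp a s y - 1‖ := norm_sub_le_norm_sub_add_norm_sub _ _ _
        _ ≤ e * (D * ∑ i with i < k, a i k ^ 2) + e * (D * ∑ k ∈ s, ∑ i with i < k, a i k ^ 2) := by
            refine add_le_add (h.trans ?_) ih
            exact mul_le_mul_of_nonneg_right hle
              (mul_nonneg hD0 (Finset.sum_nonneg fun _ _ => sq_nonneg _))
        _ = _ := by ring
  set B : (V → Fin c) → ℝ := quadForm (varCoeff c a Finset.univ) Finset.univ with hBdef
  have eB : 𝔼 y, |B y| ≤ η :=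
    expect_abs_le_of_sq_le hη ((expect_quadForm_varCoeff_sq_le a _).trans (hB _))
  -- Dropping the correction factor costs at most the mean size of the total fluctuation.
  have h1 : ‖𝔼 y : V → Fin c, exp (I * quadForm a Finset.univ y) * (e : ℂ) -
      𝔼 y : V → Fin c, tiltedExp a Finset.univ y‖ ≤ e * η := by
    rw [← Finset.expect_sub_distrib]
    calc _ ≤ 𝔼 y, e * |B y| := by
          refine (norm_expect_le_expect_norm _).trans (Finset.expect_le_expect fun y _ => ?_)
          rw [tiltedExp, mul_add, mul_one, sub_add_cancel_left, norm_neg, norm_mul, norm_mul,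
            norm_exp_I_mul_ofReal, one_mul, norm_real, Real.norm_of_nonneg he0, norm_div,
            norm_real, Real.norm_eq_abs, RCLike.norm_ofNat]
          gcongr
          linarith [abs_nonneg (quadForm (varCoeff c a Finset.univ) Finset.univ y)]
      _ ≤ e * η := by
          rw [← Finset.mul_expect]
          gcongr
  have hf : Real.exp (-∑ k, incrVar c a k / 2) ≤ 1 := Real.exp_le_one_iff.2 (neg_nonpos.2
    (Finset.sum_nonneg fun j _ => div_nonneg (incrVar_nonneg a j) two_pos.le))
  have hfe : (e : ℂ) * (Real.exp (-∑ k, incrVar c a k / 2) : ℂ) = 1 := by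
    rw [he, ← ofReal_mul, ← Real.exp_add]
    simp
  have h2 : 𝔼 y : V → Fin c, exp (I * quadForm a Finset.univ y) -
        Real.exp (-∑ k, incrVar c a k / 2) =
      (𝔼 y : V → Fin c, exp (I * quadForm a Finset.univ y) * (e : ℂ) - 1) *
        Real.exp (-∑ k, incrVar c a k / 2) := by
    rw [← Finset.expect_mul, sub_mul, mul_assoc, hfe]
    simp
  rw [h2, norm_mul, norm_real, Real.norm_of_nonneg (Real.exp_pos _).le]
  refine (mul_le_of_le_one_right (norm_nonneg _) hf).trans ?_
  calc _ ≤ _ := norm_sub_le_norm_sub_add_norm_sub _ (𝔼 y : V → Fin c, tiltedExp a Finset.univ y) _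
    _ ≤ e * η + e * (D * ∑ k, ∑ i with i < k, a i k ^ 2) := add_le_add h1 (main _)
    _ = _ := by ring

end Bounds

end CharacteristicFunction

/-! ### Edge and 4-cycle counts as sums over vertices. -/

section GraphForms

variable {V : Type*}

open Classical in
/-- The indicator of adjacency as a real number. -/
noncomputable def adjInd (G : SimpleGraph V) (i j : V) : ℝ := if G.Adj i j then 1 else 0

variable (G : SimpleGraph V)

lemma adjInd_comm (i j : V) : adjInd G i j = adjInd G j i := by
  by_cases h : G.Adj i j
  · simp [adjInd, h, h.symm]
  · simp [adjInd, h, mt (fun h' : G.Adj j i => h'.symm) h]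

lemma adjInd_self (i : V) : adjInd G i i = 0 := by
  simp [adjInd]

lemma adjInd_nonneg (i j : V) : 0 ≤ adjInd G i j := by
  unfold adjInd; split_ifs <;> norm_num

lemma adjInd_le_one (i j : V) : adjInd G i j ≤ 1 := by
  unfold adjInd; split_ifs <;> norm_num

lemma adjInd_mul_self (i j : V) : adjInd G i j * adjInd G i j = adjInd G i j := by
  unfold adjInd; split_ifs <;> norm_num

lemma sum_adjInd_sq (τ : ℝ) (s : Finset V) (k : V) :
    ∑ i ∈ s, (τ * adjInd G i k) ^ 2 = τ ^ 2 * ∑ i ∈ s, adjInd G i k := by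
  rw [Finset.mul_sum]
  refine Finset.sum_congr rfl fun i _ => ?_
  rw [mul_pow, sq (adjInd G i k), adjInd_mul_self]

variable [Fintype V]

/-- The number of edges as a real number, by the handshake lemma. -/
noncomputable def edgeNum (G : SimpleGraph V) : ℝ := (∑ i, ∑ j, adjInd G i j) / 2

/-- The sum over all edges of the centered indicator that the edge is monochromatic. -/
noncomputable def edgeForm {c : ℕ} (G : SimpleGraph V) (y : V → Fin c) : ℝ :=
  (∑ i, ∑ j, adjInd G i j * matchKernel (y i) (y j)) / 2

open Classical in
/-- The number of labelled 4-cycles `i, k, j, l` as a real number. -/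
noncomputable def cycleNum (G : SimpleGraph V) : ℝ :=
  ∑ i, ∑ j, ∑ k, ∑ l, if i ≠ j ∧ k ≠ l then
    adjInd G i k * adjInd G k j * adjInd G j l * adjInd G l i else 0

end GraphForms

/-! ### Graphs ordered by decreasing degree. -/

section Ordered

variable {V : Type*} [Fintype V] [LinearOrder V] (G : SimpleGraph V)

lemma edgeNum_eq_sum_lt : edgeNum G = ∑ k, ∑ i with i < k, adjInd G i k := by
  rw [edgeNum, sum_sum_eq_diag_add_two_mul (adjInd_comm G)]
  simp [adjInd_self]

lemma edgeForm_eq_sum_lt {c : ℕ} (y : V → Fin c) :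
    edgeForm G y = ∑ k, ∑ i with i < k, adjInd G i k * matchKernel (y i) (y k) := by
  rw [edgeForm, sum_sum_eq_diag_add_two_mul fun i j => by rw [adjInd_comm, matchKernel_comm]]
  simp [adjInd_self]

lemma quadForm_adjInd {c : ℕ} (τ : ℝ) (y : V → Fin c) :
    quadForm (fun i k => τ * adjInd G i k) Finset.univ y = τ * edgeForm G y := by
  rw [edgeForm_eq_sum_lt, quadForm, Finset.mul_sum]
  refine Finset.sum_congr rfl fun k _ => ?_
  rw [linForm, Finset.mul_sum]
  exact Finset.sum_congr rfl fun i _ => by ring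

/-- If the degrees are decreasing along the order, a vertex has at most `√(2|E|)` smaller
neighbors. -/
lemma backDegree_sq_le (hdeg : ∀ u v, u < v → ∑ j, adjInd G v j ≤ ∑ j, adjInd G u j) (k : V) :
    (∑ i with i < k, adjInd G i k) ^ 2 ≤ 2 * edgeNum G := by
  have hd : ∑ i with i < k, adjInd G i k ≤ ∑ j, adjInd G k j := by
    simp_rw [adjInd_comm G _ k]
    exact Finset.sum_le_sum_of_subset_of_nonneg (Finset.subset_univ _)
      fun _ _ _ => adjInd_nonneg G _ _
  calc (∑ i with i < k, adjInd G i k) ^ 2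
      = ∑ i with i < k, adjInd G i k * ∑ i with i < k, adjInd G i k := by
        rw [sq, Finset.sum_mul]
    -- Each earlier neighbor of k has degree at least that of k, hence at least the back-degree; the
    -- degrees sum to 2m.
    _ ≤ ∑ i with i < k, ∑ j, adjInd G i j := by
        refine Finset.sum_le_sum fun i hi => ?_
        have hik : i < k := by simpa using hi
        refine (mul_le_of_le_one_left ?_ (adjInd_le_one G _ _)).trans (hd.trans (hdeg i k hik))
        exact Finset.sum_nonneg fun _ _ => adjInd_nonneg G _ _
    _ ≤ ∑ i, ∑ j, adjInd G i j :=
        Finset.sum_le_sum_of_subset_of_nonneg (Finset.subset_univ _)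
          fun _ _ _ => Finset.sum_nonneg fun _ _ => adjInd_nonneg G _ _
    _ = 2 * edgeNum G := by rw [edgeNum]; ring

/-- A squared codegree counts ordered pairs (k, l) of common later neighbors. Pairs with k ≠ l close
a labelled 4-cycle. Pairs with k = l are paths centered at k, at most the sum over k of squared
back-degrees, which is at most D times the number of edges. -/
lemma sum_backCodegree_sq_le {D : ℝ} (hD : ∀ k, ∑ i with i < k, adjInd G i k ≤ D) :
    ∑ j, ∑ i with i < j, (∑ k with j < k, adjInd G i k * adjInd G j k) ^ 2 ≤
      cycleNum G + edgeNum G * D := by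
  have hA := adjInd_nonneg G
  have hsplit : ∀ i j, (∑ k with j < k, adjInd G i k * adjInd G j k) ^ 2 ≤
      (∑ k, ∑ l, if k ≠ l then
        adjInd G i k * adjInd G k j * adjInd G j l * adjInd G l i else 0) +
      ∑ k with j < k, adjInd G i k * adjInd G j k := by
    intro i j
    calc (∑ k with j < k, adjInd G i k * adjInd G j k) ^ 2
        = ∑ k with j < k, ∑ l with j < l, ((if k ≠ l then
            adjInd G i k * adjInd G k j * adjInd G j l * adjInd G l i else 0) +
            if k = l then adjInd G i k * adjInd G j k else 0) := by
          rw [sq, Finset.sum_mul_sum]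
          refine Finset.sum_congr rfl fun k _ => Finset.sum_congr rfl fun l _ => ?_
          by_cases h : k = l
          · subst h
            have h1 := adjInd_mul_self G i k
            have h2 := adjInd_mul_self G j k
            simp only [ne_eq, not_true_eq_false, if_false, if_true, zero_add]
            calc _ = (adjInd G i k * adjInd G i k) * (adjInd G j k * adjInd G j k) := by ring
              _ = _ := by rw [h1, h2]
          · simp only [ne_eq, h, not_false_eq_true, if_true, if_false, add_zero]
            rw [adjInd_comm G k j, adjInd_comm G l i]
            ring
      _ = (∑ k with j < k, ∑ l with j < l, if k ≠ l then
            adjInd G i k * adjInd G k j * adjInd G j l * adjInd G l i else 0) +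
          ∑ k with j < k, adjInd G i k * adjInd G j k := by
          simp_rw [Finset.sum_add_distrib]
          congr 1
          refine Finset.sum_congr rfl fun k hk => ?_
          rw [Finset.sum_ite_eq, if_pos hk]
      _ ≤ _ := by
          have h0 : ∀ k l, 0 ≤ if k ≠ l then
              adjInd G i k * adjInd G k j * adjInd G j l * adjInd G l i else 0 := by
            intro k l
            split_ifs
            · exact mul_nonneg (mul_nonneg (mul_nonneg (hA _ _) (hA _ _)) (hA _ _)) (hA _ _)
            · exact le_rfl
          gcongr
          refine (Finset.sum_le_sum_of_subset_of_nonneg (Finset.subset_univ _) fun _ _ _ =>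
            Finset.sum_nonneg fun _ _ => h0 _ _).trans (Finset.sum_le_sum fun k _ => ?_)
          exact Finset.sum_le_sum_of_subset_of_nonneg (Finset.subset_univ _) fun _ _ _ => h0 _ _
  calc _ ≤ ∑ j, ∑ i with i < j, ((∑ k, ∑ l, if k ≠ l then
        adjInd G i k * adjInd G k j * adjInd G j l * adjInd G l i else 0) +
      ∑ k with j < k, adjInd G i k * adjInd G j k) :=
        Finset.sum_le_sum fun j _ => Finset.sum_le_sum fun i _ => hsplit i j
    _ = (∑ j, ∑ i with i < j, ∑ k, ∑ l, if k ≠ l then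
        adjInd G i k * adjInd G k j * adjInd G j l * adjInd G l i else 0) +
        ∑ j, ∑ i with i < j, ∑ k with j < k, adjInd G i k * adjInd G j k := by
        simp_rw [Finset.sum_add_distrib]
    _ ≤ cycleNum G + edgeNum G * D := by
        refine add_le_add ?_ ?_
        · rw [cycleNum, Finset.sum_comm]
          simp_rw [Finset.sum_filter]
          refine Finset.sum_le_sum fun j _ => Finset.sum_le_sum fun i _ => ?_
          have h0 : ∀ k l, 0 ≤ adjInd G i k * adjInd G k j * adjInd G j l * adjInd G l i :=
            fun k l => mul_nonneg (mul_nonneg (mul_nonneg (hA _ _) (hA _ _)) (hA _ _)) (hA _ _)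
          split_ifs with h
          · refine Finset.sum_le_sum fun k _ => Finset.sum_le_sum fun l _ => ?_
            by_cases hkl : k = l <;> simp [hkl, h.ne]
          · refine Finset.sum_nonneg fun k _ => Finset.sum_nonneg fun l _ => ?_
            split_ifs
            · exact h0 k l
            · exact le_rfl
        · calc ∑ j, ∑ i with i < j, ∑ k with j < k, adjInd G i k * adjInd G j k
              ≤ ∑ j, ∑ i, ∑ k, if i < k ∧ j < k then adjInd G i k * adjInd G j k else 0 := by
                simp_rw [Finset.sum_filter]
                refine Finset.sum_le_sum fun j _ => Finset.sum_le_sum fun i _ => ?_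
                split_ifs with h
                · refine Finset.sum_le_sum fun k _ => ?_
                  by_cases h' : j < k
                  · simp [h', h.trans h']
                  · simp [h']
                · refine Finset.sum_nonneg fun k _ => ?_
                  split_ifs
                  · exact mul_nonneg (hA _ _) (hA _ _)
                  · exact le_rfl
            _ = ∑ k, (∑ i with i < k, adjInd G i k) * ∑ j with j < k, adjInd G j k := by
                have : ∀ j, ∑ i, ∑ k, (if i < k ∧ j < k then adjInd G i k * adjInd G j k else 0) =
                  ∑ k, ∑ i, (if i < k ∧ j < k then adjInd G i k * adjInd G j k else 0) :=
                  fun j => Finset.sum_comm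
                simp_rw [this]
                rw [Finset.sum_comm]
                refine Finset.sum_congr rfl fun k _ => ?_
                rw [Finset.sum_mul_sum, Finset.sum_comm, Finset.sum_filter]
                refine Finset.sum_congr rfl fun i _ => ?_
                rw [Finset.sum_filter]
                split_ifs with h
                · exact Finset.sum_congr rfl fun j _ => by simp [h]
                · simp [h]
            _ ≤ ∑ k, (∑ i with i < k, adjInd G i k) * D := by
                refine Finset.sum_le_sum fun k _ => ?_
                exact mul_le_mul_of_nonneg_left (hD k) (Finset.sum_nonneg fun _ _ => hA _ _)
            _ = edgeNum G * D := by rw [edgeNum_eq_sum_lt, Finset.sum_mul]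

lemma norm_expect_exp_edgeForm_sub_le_of_sorted {c : ℕ} [NeZero c]
    (hdeg : ∀ u v, u < v → ∑ j, adjInd G v j ≤ ∑ j, adjInd G u j) {τ ρ : ℝ} (hρ : 0 ≤ ρ)
    (h1 : τ ^ 2 * √(2 * edgeNum G) ≤ ρ ^ 2)
    (h2 : 400 * τ ^ 4 * (cycleNum G + edgeNum G * √(2 * edgeNum G)) ≤ ρ ^ 2) :
    ‖𝔼 y : V → Fin c, Complex.exp (Complex.I * ((τ * edgeForm G y : ℝ) : ℂ)) -
        Real.exp (-(1 / (c : ℝ) * (1 - 1 / c) * (τ ^ 2 * edgeNum G)) / 2)‖ ≤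
      Real.exp (1 / (c : ℝ) * (1 - 1 / c) * (τ ^ 2 * edgeNum G) / 2) *
        ((192 * ρ + 6 * ρ ^ 2) * (τ ^ 2 * edgeNum G) + ρ) := by
  have hc : (1 : ℝ) ≤ c := by exact_mod_cast NeZero.one_le
  have hD : ∀ k, ∑ i with i < k, adjInd G i k ≤ √(2 * edgeNum G) := fun k =>
    Real.le_sqrt_of_sq_le (backDegree_sq_le G hdeg k)
  set a : V → V → ℝ := fun i k => τ * adjInd G i k with ha
  have hw : ∀ k, ∑ i with i < k, a i k ^ 2 ≤ ρ ^ 2 := by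
    intro k
    rw [ha, sum_adjInd_sq]
    exact (mul_le_mul_of_nonneg_left (hD k) (sq_nonneg _)).trans h1
  have hsum : ∑ k, ∑ i with i < k, a i k ^ 2 = τ ^ 2 * edgeNum G := by
    simp_rw [ha, sum_adjInd_sq, ← Finset.mul_sum, edgeNum_eq_sum_lt]
  have hvar : ∑ k, incrVar c a k / 2 = 1 / (c : ℝ) * (1 - 1 / c) * (τ ^ 2 * edgeNum G) / 2 := by
    rw [← Finset.sum_div, ← hsum, Finset.mul_sum]
    rfl
  have hB : ∀ s, 100 * ∑ j, ∑ i with i < j, varCoeff c a s i j ^ 2 ≤ ρ ^ 2 := by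
    intro s
    have h4 : (2 / (c : ℝ)) ^ 2 ≤ 4 := by
      have : 2 / (c : ℝ) ≤ 2 := by rw [div_le_iff₀ (by positivity)]; linarith
      have : 0 ≤ 2 / (c : ℝ) := by positivity
      nlinarith
    have hle : ∀ i j, varCoeff c a s i j ^ 2 ≤
        4 * τ ^ 4 * (∑ k with j < k, adjInd G i k * adjInd G j k) ^ 2 := by
      intro i j
      have e : varCoeff c a s i j =
          2 / (c : ℝ) * τ ^ 2 * ∑ k ∈ s with j < k, adjInd G i k * adjInd G j k := by
        rw [varCoeff, mul_assoc, Finset.mul_sum _ _ (τ ^ 2)]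
        congr 1
        exact Finset.sum_congr rfl fun k _ => by simp only [ha]; ring
      have hnn : ∀ k, 0 ≤ adjInd G i k * adjInd G j k := fun k =>
        mul_nonneg (adjInd_nonneg G _ _) (adjInd_nonneg G _ _)
      calc varCoeff c a s i j ^ 2 = (2 / (c : ℝ)) ^ 2 * τ ^ 4 *
            (∑ k ∈ s with j < k, adjInd G i k * adjInd G j k) ^ 2 := by rw [e]; ring
        _ ≤ 4 * τ ^ 4 * (∑ k with j < k, adjInd G i k * adjInd G j k) ^ 2 := by
            gcongr
            · exact Finset.sum_nonneg fun k _ => hnn k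
            · exact fun _ _ _ => hnn _
            · exact Finset.subset_univ s
    calc _ ≤ 100 * ∑ j, ∑ i with i < j,
          4 * τ ^ 4 * (∑ k with j < k, adjInd G i k * adjInd G j k) ^ 2 := by
          gcongr
          exact hle _ _
      _ = 400 * τ ^ 4 *
          ∑ j, ∑ i with i < j, (∑ k with j < k, adjInd G i k * adjInd G j k) ^ 2 := by
          simp_rw [← Finset.mul_sum]
          ring
      _ ≤ 400 * τ ^ 4 * (cycleNum G + edgeNum G * √(2 * edgeNum G)) := by
          gcongr
          exact sum_backCodegree_sq_le G hD
      _ ≤ ρ ^ 2 := h2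
  -- With κ = η = ρ the linear constants combine as 160 + 32 = 192.
  have h := norm_expect_exp_quadForm_sub_le (c := c) hρ hρ hw hB
  rw [hvar, hsum] at h
  have hq : ∀ y : V → Fin c, quadForm a Finset.univ y = τ * edgeForm G y := quadForm_adjInd G τ
  simp_rw [hq] at h
  rw [neg_div]
  convert h using 4
  ring

end Ordered

/-! ### The Gaussian approximation for a fixed graph. -/

section CharFunBound

/-- A bound on the distance of the characteristic function of `edgeForm` to a Gaussian one. -/
lemma norm_expect_exp_edgeForm_sub_le {V : Type*} [Fintype V] [DecidableEq V] (G : SimpleGraph V)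
    {c : ℕ} [NeZero c] {τ ρ : ℝ} (hρ : 0 ≤ ρ)
    (h1 : τ ^ 2 * √(2 * edgeNum G) ≤ ρ ^ 2)
    (h2 : 400 * τ ^ 4 * (cycleNum G + edgeNum G * √(2 * edgeNum G)) ≤ ρ ^ 2) :
    ‖𝔼 y : V → Fin c, Complex.exp (Complex.I * ((τ * edgeForm G y : ℝ) : ℂ)) -
        Real.exp (-(1 / (c : ℝ) * (1 - 1 / c) * (τ ^ 2 * edgeNum G)) / 2)‖ ≤
      Real.exp (1 / (c : ℝ) * (1 - 1 / c) * (τ ^ 2 * edgeNum G) / 2) *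
        ((192 * ρ + 6 * ρ ^ 2) * (τ ^ 2 * edgeNum G) + ρ) := by
  -- Sorting by negated degree, with ties broken by an enumeration, gives a linear order with
  -- decreasing degrees.
  let key : V → ℝ ×ₗ Fin (Fintype.card V) :=
    fun v => toLex (-∑ j, adjInd G v j, Fintype.equivFin V v)
  have hkey : Function.Injective key := fun u v h => by
    have := congrArg (fun p => (ofLex p).2) h
    simpa [key] using this
  let : LinearOrder V := LinearOrder.lift' key hkey
  have hdeg : ∀ u v : V, u < v → ∑ j, adjInd G v j ≤ ∑ j, adjInd G u j := by
    intro u v huv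
    have h : key u < key v := huv
    rcases Prod.Lex.lt_iff.1 h with h | h
    · exact (neg_lt_neg_iff.1 h).le
    · exact (neg_inj.1 h.1).ge
  convert norm_expect_exp_edgeForm_sub_le_of_sorted G (c := c) hdeg hρ h1 h2

/-- Here x = √(2m) and K/m is the squared scale τ². The two conditions on x say that m is large in
terms of K and ρ; cycles and paths each receive half of the second budget. -/
lemma charFun_parameter_bounds {K ρ m x L : ℝ} (hρ : 0 < ρ) (hm : 0 < m) (hx : 0 < x)
    (hxm : x * x = 2 * m) (h1 : 2 * K ≤ ρ ^ 2 * x) (h2 : 1600 * K ^ 2 ≤ ρ ^ 2 * x)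
    (hL : L ≤ ρ ^ 2 / (800 * (K ^ 2 + 1)) * m ^ 2) :
    K / m * x ≤ ρ ^ 2 ∧ 400 * (K / m) ^ 2 * (L + m * x) ≤ ρ ^ 2 := by
  constructor
  · rw [div_mul_eq_mul_div, div_le_iff₀ hm]
    have h3 : 2 * K * x ≤ ρ ^ 2 * x * x := mul_le_mul_of_nonneg_right h1 hx.le
    have h4 : ρ ^ 2 * x * x = 2 * (ρ ^ 2 * m) := by rw [mul_assoc, hxm]; ring
    linarith
  · have e : 400 * (K / m) ^ 2 * (L + m * x) = 400 * K ^ 2 * (L + m * x) / m ^ 2 := by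
      rw [div_pow]; ring
    rw [e, div_le_iff₀ (by positivity)]
    have e1 : 400 * K ^ 2 * L ≤ ρ ^ 2 * m ^ 2 / 2 := by
      calc 400 * K ^ 2 * L ≤ 400 * K ^ 2 * (ρ ^ 2 / (800 * (K ^ 2 + 1)) * m ^ 2) := by gcongr
        _ ≤ 400 * (K ^ 2 + 1) * (ρ ^ 2 / (800 * (K ^ 2 + 1)) * m ^ 2) := by gcongr; linarith
        _ = ρ ^ 2 * m ^ 2 / 2 := by field_simp; ring
    have h3 : 1600 * K ^ 2 * x ≤ ρ ^ 2 * x * x := mul_le_mul_of_nonneg_right h2 hx.le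
    have h4 : ρ ^ 2 * x * x = 2 * (ρ ^ 2 * m) := by rw [mul_assoc, hxm]; ring
    have h5 : 800 * K ^ 2 * x * m ≤ ρ ^ 2 * m * m :=
      mul_le_mul_of_nonneg_right (by linarith) hm.le
    have e2 : 400 * K ^ 2 * (m * x) = 800 * K ^ 2 * x * m / 2 := by ring
    rw [mul_add, e2]
    have e3 : ρ ^ 2 * m * m = ρ ^ 2 * m ^ 2 := by ring
    linarith

lemma exists_norm_expect_exp_edgeForm_sub_le (c : ℕ) [NeZero c] (t : ℝ) {ε : ℝ} (hε : 0 < ε) :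
    ∃ δ > 0, ∃ M > 0, ∀ (n : ℕ) (G : SimpleGraph (Fin n)), M ≤ edgeNum G →
      cycleNum G ≤ δ * edgeNum G ^ 2 →
      ‖𝔼 y : Fin n → Fin c,
          Complex.exp (Complex.I * ((t * (edgeForm G y / √(edgeNum G / c)) : ℝ) : ℂ)) -
        Real.exp (-((1 - 1 / (c : ℝ)) * t ^ 2) / 2)‖ ≤ ε := by
  have hc : (0 : ℝ) < c := by exact_mod_cast NeZero.pos c
  obtain ⟨ρ, hρ, hρε⟩ : ∃ ρ : ℝ, 0 < ρ ∧ Real.exp ((1 - 1 / (c : ℝ)) * t ^ 2 / 2) *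
      ((192 * ρ + 6 * ρ ^ 2) * (t ^ 2 * c) + ρ) ≤ ε := by
    have hcont : Continuous fun ρ : ℝ => Real.exp ((1 - 1 / (c : ℝ)) * t ^ 2 / 2) *
      ((192 * ρ + 6 * ρ ^ 2) * (t ^ 2 * c) + ρ) := by fun_prop
    have h0 := (hcont.tendsto' 0 0 (by simp)).eventually_le_const hε
    obtain ⟨ρ, h⟩ := ((h0.filter_mono nhdsWithin_le_nhds).and
      (self_mem_nhdsWithin : Set.Ioi (0 : ℝ) ∈ 𝓝[>] 0)).exists
    exact ⟨ρ, h.2, h.1⟩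
  set K := t ^ 2 * c with hK
  have hK0 : 0 ≤ K := by positivity
  -- A threshold for √(2m) that meets both largeness conditions at once.
  set X := 1 + 2 * K / ρ ^ 2 + 1600 * K ^ 2 / ρ ^ 2 with hX
  have hX0 : 0 < X := by positivity
  refine ⟨ρ ^ 2 / (800 * (K ^ 2 + 1)), by positivity, X ^ 2 / 2, by positivity, ?_⟩
  intro n G hM hL
  set m := edgeNum G with hm
  have hm0 : 0 < m := lt_of_lt_of_le (by positivity) hM
  set x := √(2 * m) with hx
  have hxX : X ≤ x := Real.le_sqrt_of_sq_le (by linarith)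
  have hx0 : 0 < x := hX0.trans_le hxX
  have hxm : x * x = 2 * m := Real.mul_self_sqrt (by positivity)
  have hs : √(m / c) ^ 2 = m / c := Real.sq_sqrt (by positivity)
  have hs0 : √(m / c) ≠ 0 := (Real.sqrt_pos.2 (by positivity)).ne'
  set τ := t / √(m / c) with hτ
  have hτ2 : τ ^ 2 = K / m := by
    rw [hτ, div_pow, hs, hK]
    field_simp
  have hτm : τ ^ 2 * m = K := by rw [hτ2]; field_simp
  have hρX : ρ ^ 2 * X ≤ ρ ^ 2 * x := by gcongr
  have hρX' : ρ ^ 2 * X = ρ ^ 2 + 2 * K + 1600 * K ^ 2 := by rw [hX]; field_simp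
  have hρ2 : 0 ≤ ρ ^ 2 := sq_nonneg _
  have hK2 : 0 ≤ K ^ 2 := sq_nonneg _
  obtain ⟨h1, h2⟩ := charFun_parameter_bounds hρ hm0 hx0 hxm (by linarith) (by linarith) hL
  rw [← hτ2] at h1 h2
  rw [show 400 * (τ ^ 2) ^ 2 = 400 * τ ^ 4 by ring] at h2
  have h := norm_expect_exp_edgeForm_sub_le G (c := c) hρ.le h1 h2
  rw [hτm] at h
  have hv : 1 / (c : ℝ) * (1 - 1 / c) * K = (1 - 1 / (c : ℝ)) * t ^ 2 := by
    rw [hK]; field_simp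
  rw [hv] at h
  have he : ∀ y : Fin n → Fin c, t * (edgeForm G y / √(m / c)) = τ * edgeForm G y := fun y => by
    rw [hτ]; ring
  simp_rw [he]
  exact h.trans hρε

end CharFunBound

/-! ### Identification with the counts in the statement. -/

section Counting

lemma edgeCount_eq_edgeNum {n : ℕ} (G : SimpleGraph (Fin n)) : (edgeCount G : ℝ) = edgeNum G := by
  classical
  have h := G.sum_degrees_eq_twice_card_edges
  have h2 : edgeCount G = G.edgeFinset.card := by
    rw [edgeCount, ← SimpleGraph.coe_edgeFinset, Set.ncard_coe_finset]
  have h3 : ∀ i, ∑ j, adjInd G i j = G.degree i := by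
    intro i
    simp [adjInd, ← SimpleGraph.card_neighborFinset_eq_degree, SimpleGraph.neighborFinset_eq_filter]
  rw [edgeNum, h2]
  simp_rw [h3]
  rw [← Nat.cast_sum, h]
  push_cast
  ring

lemma monoEdges_sub_eq_edgeForm {n c : ℕ} (G : SimpleGraph (Fin n)) (y : Fin n → Fin c) :
    (monoEdges G y : ℝ) - (edgeCount G : ℝ) / c = edgeForm G y := by
  classical
  have h : (monoEdges G y : ℝ) =
      ∑ k, ∑ i with i < k, adjInd G i k * if y i = y k then 1 else 0 := by
    rw [monoEdges]
    push_cast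
    simp_rw [Finset.sum_filter]
    rw [Finset.sum_comm]
    refine Finset.sum_congr rfl fun i _ => ?_
    rw [← Finset.filter_lt_eq_Ioi, Finset.sum_filter]
    refine Finset.sum_congr rfl fun j _ => ?_
    by_cases h1 : G.Adj i j <;> by_cases h2 : y i = y j <;> simp [adjInd, h1, h2]
  rw [h, edgeCount_eq_edgeNum, edgeNum_eq_sum_lt, edgeForm_eq_sum_lt, Finset.sum_div,
    ← Finset.sum_sub_distrib]
  refine Finset.sum_congr rfl fun k _ => ?_
  rw [Finset.sum_div, ← Finset.sum_sub_distrib]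
  refine Finset.sum_congr rfl fun i _ => ?_
  rw [matchKernel]
  ring

lemma normalizedCount_eq {n c : ℕ} (G : SimpleGraph (Fin n)) (y : Fin n → Fin c) :
    normalizedCount G y = edgeForm G y / √(edgeNum G / c) := by
  rw [normalizedCount, monoEdges_sub_eq_edgeForm, edgeCount_eq_edgeNum]

/-- The quadruple `(i, j, k, l)` spans the 4-cycle `i, k, j, l` of `G`. -/
def IsFourCycle {V : Type*} (G : SimpleGraph V) (p : V × V × V × V) : Prop :=
  (p.1 ≠ p.2.1 ∧ p.2.2.1 ≠ p.2.2.2) ∧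
    G.Adj p.1 p.2.2.1 ∧ G.Adj p.2.2.1 p.2.1 ∧ G.Adj p.2.1 p.2.2.2 ∧ G.Adj p.2.2.2 p.1

lemma cycleNum_eq_card {V : Type*} [Fintype V] (G : SimpleGraph V) :
    cycleNum G = Nat.card {p // IsFourCycle G p} := by
  classical
  rw [Nat.card_eq_fintype_card, Fintype.card_subtype, Finset.card_filter, cycleNum]
  push_cast
  simp_rw [Fintype.sum_prod_type]
  refine Finset.sum_congr rfl fun i _ => Finset.sum_congr rfl fun j _ =>
    Finset.sum_congr rfl fun k _ => Finset.sum_congr rfl fun l _ => ?_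
  unfold IsFourCycle adjInd
  by_cases h1 : (i ≠ j ∧ k ≠ l) <;> by_cases h2 : G.Adj i k <;> by_cases h3 : G.Adj k j <;>
    by_cases h4 : G.Adj j l <;> by_cases h5 : G.Adj l i <;> simp [h1, h2, h3, h4, h5]

/-- A quadruple of vertices forming a 4-cycle is a labelled copy of the 4-cycle. -/
lemma exists_copy_of_isFourCycle {V : Type*} {G : SimpleGraph V} {p : V × V × V × V}
    (hp : IsFourCycle G p) : ∃ f : SimpleGraph.Copy (SimpleGraph.cycleGraph 4) G,
      f 0 = p.1 ∧ f 1 = p.2.2.1 ∧ f 2 = p.2.1 ∧ f 3 = p.2.2.2 := by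
  obtain ⟨i, j, k, l⟩ := p
  obtain ⟨⟨hij, hkl⟩, hik, hkj, hjl, hli⟩ := hp
  refine ⟨⟨⟨![i, k, j, l], ?_⟩, ?_⟩, rfl, rfl, rfl, rfl⟩
  · intro a b hab
    fin_cases a <;> fin_cases b <;>
      first
      | (exfalso; revert hab; decide)
      | exact hik | exact hik.symm | exact hkj | exact hkj.symm
      | exact hjl | exact hjl.symm | exact hli | exact hli.symm
  · intro a b hab
    have h1 := hik.ne
    have h2 := hkj.ne
    have h3 := hjl.ne
    have h4 := hli.ne
    fin_cases a <;> fin_cases b <;> first | rfl | (exfalso; revert hab; simp_all [eq_comm])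

lemma isFourCycle_of_copy {V : Type*} {G : SimpleGraph V}
    (f : SimpleGraph.Copy (SimpleGraph.cycleGraph 4) G) : IsFourCycle G (f 0, f 2, f 1, f 3) :=
  ⟨⟨fun h => absurd (f.injective h) (by decide), fun h => absurd (f.injective h) (by decide)⟩,
    f.toHom.map_adj (by decide), f.toHom.map_adj (by decide), f.toHom.map_adj (by decide),
    f.toHom.map_adj (by decide)⟩

end Counting

/-! ### Labelled and unlabelled 4-cycles. -/

section CopyCount

open Classical in
-- Two embeddings with the same image differ by a map of the four labels, of which there are 4⁴ =
-- 256. The sharp factor 8 is not needed, since only the order of magnitude matters.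
lemma card_copy_le_mul_copyCount {V : Type*} [Fintype V] (G : SimpleGraph V) :
    Nat.card (SimpleGraph.Copy (SimpleGraph.cycleGraph 4) G) ≤
      256 * G.copyCount (SimpleGraph.cycleGraph 4) := by
  rw [Nat.card_eq_fintype_card, SimpleGraph.copyCount_eq_card_image_copyToSubgraph, ← Finset.card_univ]
  refine Finset.card_le_mul_card_image _ 256 fun H hH => ?_
  obtain ⟨f₀, -, rfl⟩ := Finset.mem_image.1 hH
  have hg : ∀ f : SimpleGraph.Copy (SimpleGraph.cycleGraph 4) G, f.toSubgraph = f₀.toSubgraph →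
      ∃ g : Fin 4 → Fin 4, ∀ a, f a = f₀ (g a) := by
    intro f hf
    have : ∀ a, ∃ b, f a = f₀ b := by
      intro a
      have h1 : f a ∈ f.toSubgraph.verts := by simp [SimpleGraph.Copy.toSubgraph]
      rw [hf] at h1
      simpa [SimpleGraph.Copy.toSubgraph, eq_comm] using h1
    exact ⟨fun a => (this a).choose, fun a => (this a).choose_spec⟩
  have hcard : Fintype.card (Fin 4 → Fin 4) = 256 := by simp
  rw [← hcard, ← Finset.card_univ]
  refine Finset.card_le_card_of_injOn
    (fun f => if h : f.toSubgraph = f₀.toSubgraph then (hg f h).choose else 0)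
    (fun _ _ => Finset.mem_coe.2 (Finset.mem_univ _)) ?_
  intro f hf f' hf' h
  have hf1 : f.toSubgraph = f₀.toSubgraph := by simpa using hf
  have hf1' : f'.toSubgraph = f₀.toSubgraph := by simpa using hf'
  simp only [hf1, hf1', dif_pos] at h
  ext a
  rw [(hg f hf1).choose_spec, (hg f' hf1').choose_spec, h]

lemma card_isFourCycle_le_card_copy {V : Type*} [Fintype V] (G : SimpleGraph V) :
    Nat.card {p // IsFourCycle G p} ≤
      Nat.card (SimpleGraph.Copy (SimpleGraph.cycleGraph 4) G) := by
  classical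
  refine Nat.card_le_card_of_injective
    (fun p : {p // IsFourCycle G p} => (exists_copy_of_isFourCycle p.2).choose) ?_
  intro p q hpq
  obtain ⟨h0, h1, h2, h3⟩ := (exists_copy_of_isFourCycle p.2).choose_spec
  obtain ⟨h0', h1', h2', h3'⟩ := (exists_copy_of_isFourCycle q.2).choose_spec
  simp only at hpq
  rw [hpq] at h0 h1 h2 h3
  ext1
  exact Prod.ext (h0.symm.trans h0') (Prod.ext (h2.symm.trans h2')
    (Prod.ext (h1.symm.trans h1') (h3.symm.trans h3')))

lemma card_copy_le_card_isFourCycle {V : Type*} [Fintype V] (G : SimpleGraph V) :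
    Nat.card (SimpleGraph.Copy (SimpleGraph.cycleGraph 4) G) ≤
      Nat.card {p // IsFourCycle G p} := by
  refine Nat.card_le_card_of_injective
    (fun f => (⟨(f 0, f 2, f 1, f 3), isFourCycle_of_copy f⟩ : {p // IsFourCycle G p})) ?_
  intro f f' h
  simp only [Subtype.mk.injEq, Prod.mk.injEq] at h
  obtain ⟨h0, h2, h1, h3⟩ := h
  ext a
  fin_cases a
  · exact h0
  · exact h1
  · exact h2
  · exact h3

lemma copyCount_le_card_copy {V : Type*} [Fintype V] (G : SimpleGraph V) :
    G.copyCount (SimpleGraph.cycleGraph 4) ≤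
      Nat.card (SimpleGraph.Copy (SimpleGraph.cycleGraph 4) G) := by
  classical
  rw [Nat.card_eq_fintype_card, SimpleGraph.copyCount_eq_card_image_copyToSubgraph,
    ← Finset.card_univ]
  exact Finset.card_image_le

lemma cycleNum_le_mul_fourCycleCount {n : ℕ} (G : SimpleGraph (Fin n)) :
    cycleNum G ≤ 256 * fourCycleCount G := by
  have h : Nat.card {p // IsFourCycle G p} ≤ 256 * fourCycleCount G :=
    (card_isFourCycle_le_card_copy G).trans (card_copy_le_mul_copyCount G)
  rw [cycleNum_eq_card]
  generalize Nat.card {p // IsFourCycle G p} = N at h ⊢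
  generalize fourCycleCount G = K at h ⊢
  exact_mod_cast h

lemma fourCycleCount_le_cycleNum {n : ℕ} (G : SimpleGraph (Fin n)) :
    (fourCycleCount G : ℝ) ≤ cycleNum G := by
  have h : fourCycleCount G ≤ Nat.card {p // IsFourCycle G p} :=
    (copyCount_le_card_copy G).trans (card_copy_le_card_isFourCycle G)
  rw [cycleNum_eq_card]
  exact Nat.cast_le.2 h

end CopyCount

/-! ### Nonnegativity of mixed moments. -/

section Positivity

variable {V : Type*} {c : ℕ}

/-- The centered indicator that an edge is monochromatic. -/
noncomputable def edgeKernel (e : Sym2 V) (y : V → Fin c) : ℝ :=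
  Sym2.lift ⟨fun i j => matchKernel (y i) (y j), fun _ _ => matchKernel_comm _ _⟩ e

lemma edgeKernel_mk (i j : V) (y : V → Fin c) :
    edgeKernel s(i, j) y = matchKernel (y i) (y j) := rfl

lemma matchKernel_sq (x y : Fin c) : matchKernel x y ^ 2 =
    (1 - 2 / (c : ℝ)) * matchKernel x y + 1 / (c : ℝ) * (1 - 1 / c) := by
  unfold matchKernel
  split_ifs <;> ring

lemma edgeKernel_sq (e : Sym2 V) (y : V → Fin c) : edgeKernel e y ^ 2 =
    (1 - 2 / (c : ℝ)) * edgeKernel e y + 1 / (c : ℝ) * (1 - 1 / c) := by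
  induction e with
  | h i j => exact matchKernel_sq _ _

variable [NeZero c]

/-- The nonnegative multiples of characters of the group of colorings. -/
def scaledChars (V : Type*) (c : ℕ) [NeZero c] : Submonoid ((V → Fin c) → ℂ) where
  carrier := {F | ∃ r : ℝ, 0 ≤ r ∧ ∃ ψ : AddChar (V → Fin c) ℂ, F = fun y => (r : ℂ) * ψ y}
  one_mem' := ⟨1, zero_le_one, 1, by ext; simp⟩
  mul_mem' := by
    rintro _ _ ⟨r, hr, ψ, rfl⟩ ⟨r', hr', ψ', rfl⟩
    refine ⟨r * r', mul_nonneg hr hr', ψ * ψ', ?_⟩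
    ext y
    simp only [Pi.mul_apply, AddChar.mul_apply, Complex.ofReal_mul]
    ring

/-- By orthogonality, 1{x = y} is the average of ψ(x - y) over all characters ψ of the group of
colors. Subtracting 1/c removes exactly the trivial character, so all remaining coefficients are
1/c. -/
lemma matchKernel_mem (i j : V) :
    (fun y : V → Fin c => (matchKernel (y i) (y j) : ℂ)) ∈
      (scaledChars V c).subsemiringClosure := by
  classical
  have hc : (c : ℂ) ≠ 0 := by exact_mod_cast NeZero.ne c
  have h : (fun y : V → Fin c => (matchKernel (y i) (y j) : ℂ)) =
      ∑ ψ ∈ (Finset.univ : Finset (AddChar (Fin c) ℂ)).erase 0, fun y : V → Fin c =>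
        ((1 / (c : ℝ) : ℝ) : ℂ) * (ψ.compAddMonoidHom
          (Pi.evalAddMonoidHom (fun _ => Fin c) i - Pi.evalAddMonoidHom (fun _ => Fin c) j)) y := by
    ext y
    rw [Finset.sum_apply, ← Finset.mul_sum]
    simp only [AddChar.compAddMonoidHom_apply, AddMonoidHom.sub_apply, Pi.evalAddMonoidHom_apply]
    have h1 := AddChar.sum_apply_eq_ite (y i - y j)
    rw [← Finset.add_sum_erase _ _ (Finset.mem_univ 0)] at h1
    rw [eq_sub_of_add_eq' h1, matchKernel]
    simp only [sub_eq_zero, AddChar.zero_apply, Fintype.card_fin]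
    split_ifs <;> push_cast <;> field_simp
    ring
  rw [h]
  refine Subsemiring.sum_mem _ fun ψ _ => ?_
  rw [← SetLike.mem_coe, Submonoid.subsemiringClosure_coe]
  exact AddSubmonoid.subset_closure ⟨1 / (c : ℝ), by positivity, _, rfl⟩

/-- The mean of a character is 1 or 0 according to whether it is trivial. -/
lemma expect_re_nonneg_of_mem [Fintype V] [DecidableEq V] {F : (V → Fin c) → ℂ}
    (hF : F ∈ (scaledChars V c).subsemiringClosure) : 0 ≤ (𝔼 y, F y).re := by
  rw [← SetLike.mem_coe, Submonoid.subsemiringClosure_coe] at hF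
  induction hF using AddSubmonoid.closure_induction with
  | mem F hF =>
    obtain ⟨r, hr, ψ, rfl⟩ := hF
    classical
    rw [← Finset.mul_expect, Complex.re_ofReal_mul, AddChar.expect_eq_ite]
    split_ifs <;> simp [hr]
  | zero => simp
  | add F F' _ _ h h' =>
    simp only [Pi.add_apply, Finset.expect_add_distrib, Complex.add_re]
    exact add_nonneg h h'

lemma edgeKernel_mem (e : Sym2 V) :
    (fun y : V → Fin c => (edgeKernel e y : ℂ)) ∈ (scaledChars V c).subsemiringClosure := by
  induction e with
  | h i j => exact matchKernel_mem i j

variable [Fintype V] [DecidableEq V]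

lemma expect_edgeKernel_mul_nonneg (e f : Sym2 V) :
    0 ≤ 𝔼 y : V → Fin c, edgeKernel e y * edgeKernel f y := by
  have h := expect_re_nonneg_of_mem (Subsemiring.mul_mem _ (edgeKernel_mem (c := c) e)
    (edgeKernel_mem f))
  simpa only [Pi.mul_apply, ← Complex.ofReal_mul, ← ofReal_expect, Complex.ofReal_re] using h

lemma expect_edgeKernel_mul_four_nonneg (e f g h : Sym2 V) :
    0 ≤ 𝔼 y : V → Fin c, edgeKernel e y * edgeKernel f y * edgeKernel g y * edgeKernel h y := by
  have hm := expect_re_nonneg_of_mem (Subsemiring.mul_mem _ (Subsemiring.mul_mem _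
    (Subsemiring.mul_mem _ (edgeKernel_mem (c := c) e) (edgeKernel_mem f)) (edgeKernel_mem g))
    (edgeKernel_mem h))
  simpa only [Pi.mul_apply, ← Complex.ofReal_mul, ← ofReal_expect, Complex.ofReal_re] using hm

lemma expect_edgeKernel_nonneg (e : Sym2 V) : 0 ≤ 𝔼 y : V → Fin c, edgeKernel e y := by
  have h := expect_re_nonneg_of_mem (edgeKernel_mem (c := c) e)
  rwa [← ofReal_expect, Complex.ofReal_re] at h

/-- A squared kernel is its variance plus 1 - 2/c times the kernel itself. For c ≥ 2 that
coefficient is nonnegative, so every term besides the product of the variances has nonnegative mean.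
-/
lemma le_expect_edgeKernel_sq_mul_sq (hc : 2 ≤ c) (e f : Sym2 V) :
    (1 / (c : ℝ) * (1 - 1 / c)) ^ 2 ≤
      𝔼 y : V → Fin c, edgeKernel e y ^ 2 * edgeKernel f y ^ 2 := by
  have hc' : (2 : ℝ) ≤ c := by exact_mod_cast hc
  set α : ℝ := 1 - 2 / (c : ℝ) with hα
  set s : ℝ := 1 / (c : ℝ) * (1 - 1 / c) with hs
  have hα0 : 0 ≤ α := by
    rw [hα, sub_nonneg, div_le_one (by linarith)]; exact hc'
  have hs0 : 0 ≤ s := by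
    have : 1 / (c : ℝ) ≤ 1 := by rw [div_le_one (by linarith)]; linarith
    have : 0 ≤ 1 - 1 / (c : ℝ) := by linarith
    positivity
  have h1 : ∀ y : V → Fin c, edgeKernel e y ^ 2 * edgeKernel f y ^ 2 =
      α ^ 2 * (edgeKernel e y * edgeKernel f y) + α * s * edgeKernel e y + α * s * edgeKernel f y
        + s ^ 2 := by
    intro y
    rw [edgeKernel_sq, edgeKernel_sq]
    ring
  simp_rw [h1, Finset.expect_add_distrib, ← Finset.mul_expect, Fintype.expect_const]
  have := expect_edgeKernel_mul_nonneg (c := c) e f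
  have := expect_edgeKernel_nonneg (c := c) e
  have := expect_edgeKernel_nonneg (c := c) f
  have : 0 ≤ α ^ 2 * 𝔼 y : V → Fin c, edgeKernel e y * edgeKernel f y := by positivity
  have : 0 ≤ α * s * 𝔼 y : V → Fin c, edgeKernel e y := by positivity
  have : 0 ≤ α * s * 𝔼 y : V → Fin c, edgeKernel f y := by positivity
  linarith

/-- Averaging over k and over l contracts each of the two paths from i to j to one kernel divided by
c; averaging over j contracts their product. -/
lemma expect_matchKernel_cycle {i j k l : V} (hij : i ≠ j) (hkl : k ≠ l) (hik : i ≠ k)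
    (hjk : j ≠ k) (hil : i ≠ l) (hjl : j ≠ l) :
    𝔼 y : V → Fin c, matchKernel (y i) (y k) * matchKernel (y k) (y j) *
      matchKernel (y j) (y l) * matchKernel (y l) (y i) = ((c : ℝ) - 1) / c ^ 4 := by
  have hc : (c : ℝ) ≠ 0 := by exact_mod_cast NeZero.ne c
  have h1 : ∀ (y : V → Fin c), 𝔼 b, matchKernel (y i) b * matchKernel b (y j) =
      matchKernel (y i) (y j) / c := by
    intro y
    rw [← expect_matchKernel_mul]
    exact Finset.expect_congr rfl fun b _ => by rw [matchKernel_comm b]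
  rw [← expect_expect_update k]
  simp only [Function.update_self, Function.update_of_ne hik, Function.update_of_ne hjk,
    Function.update_of_ne hkl.symm, ← Finset.expect_mul, h1]
  rw [← expect_expect_update l]
  have h2 : ∀ (y : V → Fin c), 𝔼 b, matchKernel (y i) (y j) / c * matchKernel (y j) b *
      matchKernel b (y i) = (matchKernel (y i) (y j) / c) ^ 2 := by
    intro y
    have : ∀ b, matchKernel (y i) (y j) / c * matchKernel (y j) b * matchKernel b (y i) =
      matchKernel (y i) (y j) / c * (matchKernel (y i) b * matchKernel b (y j)) := fun b => by
      rw [matchKernel_comm b (y i), matchKernel_comm b (y j)]; ring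
    simp_rw [this, ← Finset.mul_expect, h1]
    ring
  simp only [Function.update_self, Function.update_of_ne hil, Function.update_of_ne hjl, h2]
  rw [← expect_expect_update j]
  have h3 : ∀ (y : V → Fin c), 𝔼 b, (matchKernel (y i) b / c) ^ 2 =
      ((c : ℝ) - 1) / c ^ 4 := by
    intro y
    have : ∀ b, (matchKernel (y i) b / c) ^ 2 =
      1 / (c : ℝ) ^ 2 * (matchKernel (y i) b * matchKernel (y i) b) := fun b => by ring
    simp_rw [this, ← Finset.mul_expect, expect_matchKernel_mul, matchKernel_self]
    field_simp
  simp only [Function.update_self, Function.update_of_ne hij, h3, Fintype.expect_const]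

end Positivity

/-! ### The fourth moment for a fixed graph. -/

section FourthMoment

lemma sum_edgeFinset_eq {V : Type*} [Fintype V] [LinearOrder V] (G : SimpleGraph V)
    [Fintype G.edgeSet] (g : Sym2 V → ℝ) :
    ∑ e ∈ G.edgeFinset, g e = ∑ k, ∑ i with i < k, adjInd G i k * g s(i, k) := by
  classical
  have himg : G.edgeFinset =
      (Finset.univ.filter fun p : V × V => p.2 < p.1 ∧ G.Adj p.2 p.1).image
        fun p => s(p.2, p.1) := by
    ext e
    induction e with
    | h a b =>
      simp only [SimpleGraph.mem_edgeFinset, SimpleGraph.mem_edgeSet, Finset.mem_image,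
        Finset.mem_filter, Finset.mem_univ, true_and, Prod.exists]
      constructor
      · intro h
        rcases lt_or_gt_of_ne h.ne with hab | hab
        · exact ⟨b, a, ⟨hab, h⟩, rfl⟩
        · exact ⟨a, b, ⟨hab, h.symm⟩, Sym2.eq_swap⟩
      · rintro ⟨x, y, ⟨-, h⟩, he⟩
        rw [← SimpleGraph.mem_edgeSet, ← he]
        exact h
  rw [himg, Finset.sum_image, Finset.sum_filter, Fintype.sum_prod_type]
  · refine Finset.sum_congr rfl fun k _ => ?_
    rw [Finset.sum_filter]
    refine Finset.sum_congr rfl fun i _ => ?_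
    by_cases h1 : i < k <;> by_cases h2 : G.Adj i k <;> simp [adjInd, h1, h2]
  · rintro ⟨a, b⟩ hab ⟨a', b'⟩ hab' h
    have h1 : b < a := by simp at hab; exact hab.1
    have h2 : b' < a' := by simp at hab'; exact hab'.1
    rcases Sym2.eq_iff.1 h with ⟨h3, h4⟩ | ⟨h3, h4⟩
    · simp only at h3 h4
      rw [h3, h4]
    · simp only at h3 h4
      rw [h3, h4] at h1
      exact absurd h1 h2.not_gt

/-- The edges of a labelled 4-cycle, in cyclic order. -/
def cycleEdges {V : Type*} (p : V × V × V × V) : Sym2 V × Sym2 V × Sym2 V × Sym2 V :=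
  (s(p.1, p.2.2.1), s(p.2.2.1, p.2.1), s(p.2.1, p.2.2.2), s(p.2.2.2, p.1))

/-- Consecutive edges of a 4-cycle share exactly one vertex, so the ordered edges determine the
labelling. -/
lemma cycleEdges_injOn {V : Type*} {G : SimpleGraph V} {p q : V × V × V × V}
    (hp : IsFourCycle G p) (hq : IsFourCycle G q) (h : cycleEdges p = cycleEdges q) : p = q := by
  obtain ⟨i, j, k, l⟩ := p
  obtain ⟨i', j', k', l'⟩ := q
  obtain ⟨⟨hij, hkl⟩, hik, hkj, hjl, hli⟩ := hp
  have h1 := hik.ne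
  have h2 := hkj.ne
  have h3 := hjl.ne
  have h4 := hli.ne
  simp only [cycleEdges, Prod.mk.injEq, Sym2.eq_iff] at h hij hkl h1 h2 h3 h4 ⊢
  grind

variable {V : Type*} [Fintype V] [LinearOrder V] {c : ℕ} [NeZero c]

open Classical in
-- The three pairings and the 4-cycle pattern exclude one another, so at most one indicator is 1;
-- when none is, nonnegativity of the moment suffices. On a cycle, c - 1 ≥ 1 gives the value 1/c⁴.
lemma le_expect_edgeKernel_mul_four (hc : 2 ≤ c) (G : SimpleGraph V) (e f g h : Sym2 V) :
    (1 / (c : ℝ) * (1 - 1 / c)) ^ 2 *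
        ((if e = f ∧ g = h ∧ e ≠ g then 1 else 0) + (if e = g ∧ f = h ∧ e ≠ f then 1 else 0) +
          (if e = h ∧ f = g ∧ e ≠ f then 1 else 0)) +
      1 / (c : ℝ) ^ 4 * (if ∃ p, IsFourCycle G p ∧ cycleEdges p = (e, f, g, h) then 1 else 0) ≤
    𝔼 y : V → Fin c, edgeKernel e y * edgeKernel f y * edgeKernel g y * edgeKernel h y := by
  have hc' : (2 : ℝ) ≤ c := by exact_mod_cast hc
  by_cases hcyc : ∃ p, IsFourCycle G p ∧ cycleEdges p = (e, f, g, h)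
  · obtain ⟨⟨i, j, k, l⟩, hp, hpe⟩ := id hcyc
    obtain ⟨⟨hij, hkl⟩, hik, hkj, hjl, hli⟩ := hp
    have h1 := hik.ne
    have h2 := hkj.ne
    have h3 := hjl.ne
    have h4 := hli.ne
    simp only [cycleEdges, Prod.mk.injEq] at hpe hij hkl h1 h2 h3 h4
    obtain ⟨rfl, rfl, rfl, rfl⟩ := hpe
    have n1 : s(i, k) ≠ s(k, j) := by simp [h1, hij]
    have n2 : s(i, k) ≠ s(j, l) := by simp [hij, h4.symm]
    have n3 : s(i, k) ≠ s(l, i) := by simp [hkl, h4.symm]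
    rw [if_pos hcyc, if_neg fun h => n1 h.1, if_neg fun h => n2 h.1, if_neg fun h => n3 h.1]
    simp only [edgeKernel_mk]
    rw [expect_matchKernel_cycle hij hkl h1 h2.symm h4.symm h3]
    simp only [add_zero, mul_zero, zero_add, mul_one]
    gcongr
    linarith
  · rw [if_neg hcyc, mul_zero, add_zero]
    have hnn := expect_edgeKernel_mul_four_nonneg (c := c) e f g h
    by_cases c1 : e = f ∧ g = h ∧ e ≠ g
    · obtain ⟨rfl, rfl, hne⟩ := c1
      have := le_expect_edgeKernel_sq_mul_sq (c := c) hc e g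
      simp only [hne, ne_eq, not_true_eq_false, not_false_eq_true, and_self, if_true,
        if_false, add_zero, mul_one]
      refine this.trans (le_of_eq (Finset.expect_congr rfl fun y _ => by ring))
    · rw [if_neg c1]
      by_cases c2 : e = g ∧ f = h ∧ e ≠ f
      · obtain ⟨rfl, rfl, hne⟩ := c2
        have := le_expect_edgeKernel_sq_mul_sq (c := c) hc e f
        simp only [hne, ne_eq, not_false_eq_true, and_true, and_self, if_true,
          if_false, false_and, add_zero, mul_one, zero_add]
        refine this.trans (le_of_eq (Finset.expect_congr rfl fun y _ => by ring))
      · rw [if_neg c2]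
        by_cases c3 : e = h ∧ f = g ∧ e ≠ f
        · rw [if_pos c3]
          obtain ⟨rfl, rfl, hne⟩ := c3
          have := le_expect_edgeKernel_sq_mul_sq (c := c) hc e f
          simp only [mul_one, zero_add]
          refine this.trans (le_of_eq (Finset.expect_congr rfl fun y _ => by ring))
        · rw [if_neg c3]
          simpa using hnn

lemma sum_pairings {α : Type*} [DecidableEq α] (E : Finset α) :
    ∑ e ∈ E, ∑ f ∈ E, ∑ g ∈ E, ∑ h ∈ E, ((if e = f ∧ g = h ∧ e ≠ g then (1 : ℝ) else 0) +
      (if e = g ∧ f = h ∧ e ≠ f then 1 else 0) + (if e = h ∧ f = g ∧ e ≠ f then 1 else 0)) =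
    3 * ((E.card : ℝ) ^ 2 - E.card) := by
  have hcard : ∀ e ∈ E, ∑ g ∈ E, (if e ≠ g then (1 : ℝ) else 0) = E.card - 1 := by
    intro e he
    have : ∀ g, (if e ≠ g then (1 : ℝ) else 0) = 1 - if e = g then 1 else 0 := fun g => by
      by_cases h : e = g <;> simp [h]
    simp_rw [this, Finset.sum_sub_distrib, Finset.sum_ite_eq, if_pos he]
    simp
  have key : ∀ e ∈ E, ∑ f ∈ E, ∑ g ∈ E, ∑ h ∈ E,
      ((if e = f ∧ g = h ∧ e ≠ g then (1 : ℝ) else 0) +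
      (if e = g ∧ f = h ∧ e ≠ f then 1 else 0) + (if e = h ∧ f = g ∧ e ≠ f then 1 else 0)) =
      3 * (E.card - 1) := by
    intro e he
    simp_rw [Finset.sum_add_distrib]
    have a1 : ∑ f ∈ E, ∑ g ∈ E, ∑ h ∈ E, (if e = f ∧ g = h ∧ e ≠ g then (1 : ℝ) else 0) =
        E.card - 1 := by
      have : ∀ f ∈ E, ∑ g ∈ E, ∑ h ∈ E, (if e = f ∧ g = h ∧ e ≠ g then (1 : ℝ) else 0) =
          if e = f then (E.card : ℝ) - 1 else 0 := by
        intro f hf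
        by_cases hef : e = f
        · rw [if_pos hef, ← hcard e he]
          refine Finset.sum_congr rfl fun g hg => ?_
          simp only [hef, true_and, ite_and, Finset.sum_ite_eq, if_pos hg]
        · simp [hef]
      rw [Finset.sum_congr rfl this, Finset.sum_ite_eq, if_pos he]
    have a2 : ∑ f ∈ E, ∑ g ∈ E, ∑ h ∈ E, (if e = g ∧ f = h ∧ e ≠ f then (1 : ℝ) else 0) =
        E.card - 1 := by
      rw [← hcard e he]
      refine Finset.sum_congr rfl fun f hf => ?_
      simp only [ite_and, Finset.sum_ite_eq, Finset.sum_ite_irrel, Finset.sum_const_zero, if_pos hf,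
        if_pos he]
    have a3 : ∑ f ∈ E, ∑ g ∈ E, ∑ h ∈ E, (if e = h ∧ f = g ∧ e ≠ f then (1 : ℝ) else 0) =
        E.card - 1 := by
      rw [← hcard e he]
      refine Finset.sum_congr rfl fun f hf => ?_
      simp only [ite_and, Finset.sum_ite_eq, if_pos hf,
        if_pos he]
    rw [a1, a2, a3]
    ring
  rw [Finset.sum_congr rfl key]
  simp
  ring

lemma sum_four_mul_add {α : Type*} (E : Finset α) (a b : ℝ) (P Q : α → α → α → α → ℝ) :
    ∑ e ∈ E, ∑ f ∈ E, ∑ g ∈ E, ∑ h ∈ E, (a * P e f g h + b * Q e f g h) =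
      a * ∑ e ∈ E, ∑ f ∈ E, ∑ g ∈ E, ∑ h ∈ E, P e f g h +
      b * ∑ e ∈ E, ∑ f ∈ E, ∑ g ∈ E, ∑ h ∈ E, Q e f g h := by
  simp only [Finset.sum_add_distrib, Finset.mul_sum]

open Classical in
lemma cycleNum_le_sum (G : SimpleGraph V) :
    cycleNum G ≤ ∑ e ∈ G.edgeFinset, ∑ f ∈ G.edgeFinset, ∑ g ∈ G.edgeFinset, ∑ h ∈ G.edgeFinset,
      if ∃ p, IsFourCycle G p ∧ cycleEdges p = (e, f, g, h) then (1 : ℝ) else 0 := by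
  have h1 : ∑ e ∈ G.edgeFinset, ∑ f ∈ G.edgeFinset, ∑ g ∈ G.edgeFinset, ∑ h ∈ G.edgeFinset,
      (if ∃ p, IsFourCycle G p ∧ cycleEdges p = (e, f, g, h) then (1 : ℝ) else 0) =
      ((G.edgeFinset ×ˢ G.edgeFinset ×ˢ G.edgeFinset ×ˢ G.edgeFinset).filter
        fun q => ∃ p, IsFourCycle G p ∧ cycleEdges p = q).card := by
    rw [Finset.card_filter]
    push_cast
    simp_rw [Finset.sum_product]
  rw [h1, cycleNum_eq_card, Nat.card_eq_fintype_card, Fintype.card_subtype]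
  refine Nat.cast_le.2 (Finset.card_le_card_of_injOn cycleEdges ?_ ?_)
  · intro p hp
    have hp' : IsFourCycle G p := by simpa using hp
    refine Finset.mem_coe.2 (Finset.mem_filter.2 ⟨?_, p, hp', rfl⟩)
    obtain ⟨-, h1, h2, h3, h4⟩ := hp'
    simp only [cycleEdges, Finset.mem_product, SimpleGraph.mem_edgeFinset,
      SimpleGraph.mem_edgeSet]
    exact ⟨h1, h2, h3, h4⟩
  · intro p hp q hq h
    exact cycleEdges_injOn (by simpa using hp) (by simpa using hq) h

lemma edgeNum_eq_card (G : SimpleGraph V) [Fintype G.edgeSet] :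
    edgeNum G = G.edgeFinset.card := by
  have h := sum_edgeFinset_eq G fun _ => 1
  rw [edgeNum_eq_sum_lt]
  simpa using h.symm

/-- All terms in the expansion of the fourth moment are nonnegative, and those coming from pairings
and from 4-cycles give a lower bound. -/
lemma le_expect_edgeForm_pow_four (hc : 2 ≤ c) (G : SimpleGraph V) :
    3 * (1 / (c : ℝ) * (1 - 1 / c)) ^ 2 * (edgeNum G ^ 2 - edgeNum G) +
      1 / (c : ℝ) ^ 4 * cycleNum G ≤ 𝔼 y : V → Fin c, edgeForm G y ^ 4 := by
  classical
  have hS : ∀ y : V → Fin c, edgeForm G y ^ 4 = ∑ e ∈ G.edgeFinset, ∑ f ∈ G.edgeFinset,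
      ∑ g ∈ G.edgeFinset, ∑ h ∈ G.edgeFinset,
        edgeKernel e y * edgeKernel f y * edgeKernel g y * edgeKernel h y := by
    intro y
    have : edgeForm G y = ∑ e ∈ G.edgeFinset, edgeKernel e y := by
      rw [edgeForm_eq_sum_lt, sum_edgeFinset_eq]
      rfl
    rw [this]
    simp only [← Finset.mul_sum, ← Finset.sum_mul]
    ring
  simp_rw [hS, Finset.expect_sum_comm]
  calc _ ≤ ∑ e ∈ G.edgeFinset, ∑ f ∈ G.edgeFinset, ∑ g ∈ G.edgeFinset, ∑ h ∈ G.edgeFinset,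
        ((1 / (c : ℝ) * (1 - 1 / c)) ^ 2 *
        ((if e = f ∧ g = h ∧ e ≠ g then 1 else 0) + (if e = g ∧ f = h ∧ e ≠ f then 1 else 0) +
          (if e = h ∧ f = g ∧ e ≠ f then 1 else 0)) +
        1 / (c : ℝ) ^ 4 *
          (if ∃ p, IsFourCycle G p ∧ cycleEdges p = (e, f, g, h) then 1 else 0)) := by
        rw [sum_four_mul_add, sum_pairings, edgeNum_eq_card]
        refine add_le_add (le_of_eq (by ring)) ?_
        gcongr
        convert cycleNum_le_sum G
    _ ≤ _ := Finset.sum_le_sum fun e _ => Finset.sum_le_sum fun f _ => Finset.sum_le_sum fun g _ =>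
        Finset.sum_le_sum fun h _ => le_expect_edgeKernel_mul_four hc G e f g h

end FourthMoment

/-! ### Conditioning on the random graph. -/

section Law

variable {n c : ℕ}

instance : MeasurableSingletonClass (SimpleGraph (Fin n)) where
  measurableSet_singleton G := by
    have h : ({G} : Set (SimpleGraph (Fin n))) = SimpleGraph.edgeSet ⁻¹' {SimpleGraph.edgeSet G} := by
      ext G'
      simp
    rw [h]
    exact SimpleGraph.measurable_edgeSet (measurableSet_singleton _)

variable {Ω : Type*} [MeasurableSpace Ω] {P : Measure Ω}

lemma IsUniformColoring.measureReal_eq [NeZero c] [IsProbabilityMeasure P] {Y : Ω → Fin n → Fin c}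
    (hY : IsUniformColoring P Y) (y : Fin n → Fin c) :
    (P.map Y).real {y} = 1 / Fintype.card (Fin n → Fin c) := by
  have hm : ∀ i, Measurable fun ω => Y ω i := fun i => (measurable_pi_apply i).comp hY.measurable
  have h := (iIndepFun_iff_map_fun_eq_pi_map fun i => (hm i).aemeasurable).1 hY.indep
  have h1 : P.map Y {y} = ∏ _i : Fin n, (c : ℝ≥0∞)⁻¹ := by
    change P.map (fun ω i => Y ω i) {y} = _
    have : ∀ i, IsProbabilityMeasure (P.map fun ω => Y ω i) := fun i =>
      Measure.isProbabilityMeasure_map (hm i).aemeasurable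
    rw [h, Measure.pi_singleton]
    refine Finset.prod_congr rfl fun i _ => ?_
    rw [Measure.map_apply (hm i) (measurableSet_singleton _)]
    exact hY.uniform i (y i)
  rw [measureReal_def, h1]
  simp

variable {𝕜 : Type*} [RCLike 𝕜]

lemma integrable_comp_of_finite [IsProbabilityMeasure P] {S E : Type*} [Finite S]
    [MeasurableSpace S] [MeasurableSingletonClass S] [NormedAddCommGroup E] {Z : Ω → S}
    (hZ : Measurable Z) (f : S → E) :
    Integrable (fun ω => f (Z ω)) P := by
  have : IsProbabilityMeasure (P.map Z) := Measure.isProbabilityMeasure_map hZ.aemeasurable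
  exact (Integrable.of_finite (μ := P.map Z) (f := f)).comp_measurable hZ

lemma measurable_comp_of_finite {S E : Type*} [Finite S] [MeasurableSpace S]
    [MeasurableSingletonClass S] [MeasurableSpace E] {Z : Ω → S} (hZ : Measurable Z) (f : S → E) :
    Measurable fun ω => f (Z ω) :=
  (measurable_of_finite f).comp hZ

/-- Averaging over the colors first. -/
lemma integral_graph_coloring_eq [NeZero c] [IsProbabilityMeasure P]
    {G : Ω → SimpleGraph (Fin n)} {Y : Ω → Fin n → Fin c} (hG : Measurable G)
    (hY : IsUniformColoring P Y) (hGY : IndepFun G Y P)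
    (f : SimpleGraph (Fin n) → (Fin n → Fin c) → 𝕜) :
    ∫ ω, f (G ω) (Y ω) ∂P = ∫ ω, 𝔼 y, f (G ω) y ∂P := by
  have hYm := hY.measurable
  have : IsProbabilityMeasure (P.map G) := Measure.isProbabilityMeasure_map hG.aemeasurable
  have : IsProbabilityMeasure (P.map Y) := Measure.isProbabilityMeasure_map hYm.aemeasurable
  have hmap := (indepFun_iff_map_prod_eq_prod_map_map hG.aemeasurable hYm.aemeasurable).1 hGY
  have h1 : ∫ ω, f (G ω) (Y ω) ∂P = ∫ p, f p.1 p.2 ∂(P.map fun ω => (G ω, Y ω)) :=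
    (integral_map (hG.prodMk hYm).aemeasurable
      (f := fun p : SimpleGraph (Fin n) × (Fin n → Fin c) => f p.1 p.2)
      (measurable_of_finite _).aestronglyMeasurable).symm
  have h2 : ∫ ω, 𝔼 y, f (G ω) y ∂P = ∫ g, 𝔼 y, f g y ∂(P.map G) :=
    (integral_map hG.aemeasurable (f := fun g => 𝔼 y, f g y)
      (measurable_of_finite _).aestronglyMeasurable).symm
  rw [h1, h2, hmap, integral_prod _ Integrable.of_finite]
  congr 1
  ext g
  rw [integral_fintype Integrable.of_finite, Fintype.expect_eq_sum_div_card, Finset.sum_div]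
  refine Finset.sum_congr rfl fun y _ => ?_
  rw [hY.measureReal_eq, RCLike.real_smul_eq_coe_mul]
  push_cast
  ring

end Law

/-! ### The Gaussian fourth moment. -/

section GaussianMoment

open scoped NNReal

lemma integral_pow_four_gaussianReal (v : ℝ≥0) : ∫ x, x ^ 4 ∂(gaussianReal 0 v) = 3 * (v : ℝ) ^ 2 := by
  have h := iteratedDeriv_mgf_zero (X := id) (μ := gaussianReal 0 v) (by simp) 4
  rw [mgf_id_gaussianReal] at h
  simp only [zero_mul, zero_add] at h
  -- Each derivative of the moment generating function keeps the factor exp(vt²/2) and sends the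
  -- polynomial p to p' + vtp.
  have hd : ∀ (p q : ℝ → ℝ), (∀ t, HasDerivAt p (q t) t) →
      deriv (fun t => p t * Real.exp (v * t ^ 2 / 2)) =
        fun t => (q t + p t * (v * t)) * Real.exp (v * t ^ 2 / 2) := by
    intro p q hp
    ext t
    have h1 : HasDerivAt (fun t : ℝ => v * t ^ 2 / 2) (v * t) t :=
      (((hasDerivAt_pow 2 t).const_mul (v : ℝ)).div_const 2).congr_deriv (by push_cast; ring)
    refine ((hp t).mul h1.exp).deriv.trans ?_
    ring
  have e0 : (fun t : ℝ => Real.exp (v * t ^ 2 / 2)) =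
      fun t : ℝ => (fun _ => (1 : ℝ)) t * Real.exp (v * t ^ 2 / 2) := by simp
  have d1 : ∀ t : ℝ, HasDerivAt (fun _ : ℝ => (1 : ℝ)) 0 t := fun t => hasDerivAt_const _ _
  have d2 : ∀ t : ℝ, HasDerivAt (fun t : ℝ => (v : ℝ) * t) v t := fun t => by
    simpa using (hasDerivAt_id t).const_mul (v : ℝ)
  have d3 : ∀ t : ℝ, HasDerivAt (fun t : ℝ => (v : ℝ) + v ^ 2 * t ^ 2) (2 * v ^ 2 * t) t :=
    fun t => (((hasDerivAt_pow 2 t).const_mul ((v : ℝ) ^ 2)).const_add (v : ℝ)).congr_deriv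
      (by push_cast; ring)
  have d4 : ∀ t : ℝ, HasDerivAt (fun t : ℝ => 3 * (v : ℝ) ^ 2 * t + v ^ 3 * t ^ 3)
      (3 * v ^ 2 + 3 * v ^ 3 * t ^ 2) t := fun t =>
    (((hasDerivAt_id t).const_mul (3 * (v : ℝ) ^ 2)).add
      ((hasDerivAt_pow 3 t).const_mul ((v : ℝ) ^ 3))).congr_deriv (by push_cast; ring)
  have i1 : iteratedDeriv 4 (fun t : ℝ => Real.exp (v * t ^ 2 / 2)) =
      fun t => ((3 * (v : ℝ) ^ 2 + 3 * v ^ 3 * t ^ 2) + (3 * (v : ℝ) ^ 2 * t + v ^ 3 * t ^ 3) *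
        (v * t)) * Real.exp (v * t ^ 2 / 2) := by
    rw [iteratedDeriv_succ, iteratedDeriv_succ, iteratedDeriv_succ, iteratedDeriv_succ,
      iteratedDeriv_zero, e0, hd _ _ d1]
    have a1 : (fun t : ℝ => ((0 : ℝ) + 1 * (v * t)) * Real.exp (v * t ^ 2 / 2)) =
      fun t => ((v : ℝ) * t) * Real.exp (v * t ^ 2 / 2) := by ext t; ring
    rw [a1, hd _ _ d2]
    have a2 : (fun t : ℝ => ((v : ℝ) + v * t * (v * t)) * Real.exp (v * t ^ 2 / 2)) =
      fun t => ((v : ℝ) + v ^ 2 * t ^ 2) * Real.exp (v * t ^ 2 / 2) := by ext t; ring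
    rw [a2, hd _ _ d3]
    have a3 : (fun t : ℝ => (2 * (v : ℝ) ^ 2 * t + (v + v ^ 2 * t ^ 2) * (v * t)) *
        Real.exp (v * t ^ 2 / 2)) =
      fun t => (3 * (v : ℝ) ^ 2 * t + v ^ 3 * t ^ 3) * Real.exp (v * t ^ 2 / 2) := by
      ext t; ring
    rw [a3, hd _ _ d4]
  rw [i1] at h
  simpa using h.symm

end GaussianMoment

/-! ### Moments of the normalized count. -/

section Moments

variable {n c : ℕ} [NeZero c]

lemma edgeNum_eq_zero_or_one_le (G : SimpleGraph (Fin n)) : edgeNum G = 0 ∨ 1 ≤ edgeNum G := by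
  rw [← edgeCount_eq_edgeNum]
  rcases Nat.eq_zero_or_pos (edgeCount G) with h | h
  · left; simp [h]
  · right; exact_mod_cast h

lemma expect_normalizedCount_pow_six_le (G : SimpleGraph (Fin n)) :
    𝔼 y : Fin n → Fin c, normalizedCount G y ^ 6 ≤ (100 * (c : ℝ)) ^ 3 := by
  have hc : (0 : ℝ) < c := by exact_mod_cast NeZero.pos c
  simp_rw [normalizedCount_eq]
  rcases edgeNum_eq_zero_or_one_le G with h0 | h1
  · simp only [h0, zero_div, Real.sqrt_zero, div_zero]
    simp
  · have hm : 0 < edgeNum G := by linarith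
    have h := expect_quadForm_pow_six_le (c := c)
      (fun i k => (1 / √(edgeNum G / c)) * adjInd G i k) Finset.univ
    simp_rw [quadForm_adjInd, sum_adjInd_sq, ← Finset.mul_sum, ← edgeNum_eq_sum_lt] at h
    have e : (1 / √(edgeNum G / c)) ^ 2 * edgeNum G = c := by
      rw [div_pow, Real.sq_sqrt (by positivity)]
      field_simp
    rw [e] at h
    refine le_trans (le_of_eq (Finset.expect_congr rfl fun y _ => ?_)) h
    rw [one_div_mul_eq_div]

/-- The exact deficit 1/m from the pairings is replaced by 1/M plus the indicator of m ≤ M, whose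
mean over the random graph tends to 0. Without edges all quotients are 0 and the left side is
nonpositive. -/
lemma le_expect_normalizedCount_pow_four (hc : 2 ≤ c) (G : SimpleGraph (Fin n)) {M : ℝ}
    (hM : 1 ≤ M) :
    3 * (1 - 1 / (c : ℝ)) ^ 2 * (1 - 1 / M - (if edgeNum G ≤ M then 1 else 0)) +
      1 / (c : ℝ) ^ 2 * (fourCycleCount G / edgeNum G ^ 2) ≤
    𝔼 y : Fin n → Fin c, normalizedCount G y ^ 4 := by
  have hc' : (0 : ℝ) < c := by exact_mod_cast NeZero.pos c
  have hM0 : 0 < M := by linarith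
  have hMi : 0 ≤ 1 / M := by positivity
  have hσ : 0 ≤ 3 * (1 - 1 / (c : ℝ)) ^ 2 := by positivity
  simp_rw [normalizedCount_eq]
  rcases edgeNum_eq_zero_or_one_le G with h0 | h1
  · simp only [h0, zero_div, Real.sqrt_zero, div_zero, if_pos hM0.le]
    simp only [ne_eq, OfNat.ofNat_ne_zero, not_false_eq_true, zero_pow, div_zero, mul_zero,
      add_zero, Finset.expect_const_zero]
    nlinarith
  · set m := edgeNum G with hm
    have hm0 : 0 < m := by linarith
    have h := le_expect_edgeForm_pow_four hc G
    have h4 := fourCycleCount_le_cycleNum G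
    have hs : √(m / c) ^ 4 = m ^ 2 / c ^ 2 := by
      rw [show 4 = 2 * 2 from rfl, pow_mul, Real.sq_sqrt (by positivity), div_pow]
    have e : 𝔼 y : Fin n → Fin c, (edgeForm G y / √(m / c)) ^ 4 =
        c ^ 2 / m ^ 2 * 𝔼 y : Fin n → Fin c, edgeForm G y ^ 4 := by
      simp_rw [div_pow, hs, Finset.mul_expect]
      refine Finset.expect_congr rfl fun y _ => ?_
      field_simp
    have hr : 1 - 1 / M - (if m ≤ M then 1 else 0) ≤ 1 - 1 / m := by
      split_ifs with hmM
      · have : 1 / m ≤ 1 := by rw [div_le_one hm0]; exact h1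
        linarith
      · have : 1 / m ≤ 1 / M := one_div_le_one_div_of_le hM0 (not_le.1 hmM).le
        linarith
    calc _ ≤ 3 * (1 - 1 / (c : ℝ)) ^ 2 * (1 - 1 / m) + 1 / (c : ℝ) ^ 2 * (cycleNum G / m ^ 2) := by
          gcongr
      _ = c ^ 2 / m ^ 2 * (3 * (1 / (c : ℝ) * (1 - 1 / c)) ^ 2 * (m ^ 2 - m) +
          1 / (c : ℝ) ^ 4 * cycleNum G) := by
          field_simp
      _ ≤ c ^ 2 / m ^ 2 * 𝔼 y : Fin n → Fin c, edgeForm G y ^ 4 := by gcongr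
      _ = _ := e.symm

end Moments

/-! ### Passage to the limit and the two implications. -/

section Limit

lemma measurable_normalizedCount {n c : ℕ} {Ω : Type*} [MeasurableSpace Ω]
    {G : Ω → SimpleGraph (Fin n)} {Y : Ω → Fin n → Fin c} (hG : Measurable G) (hY : Measurable Y) :
    Measurable fun ω => normalizedCount (G ω) (Y ω) :=
  measurable_comp_of_finite (hG.prodMk hY) fun p : SimpleGraph (Fin n) × (Fin n → Fin c) =>
    normalizedCount p.1 p.2

lemma tendsto_measureReal_zero {Ω : ℕ → Type*} [∀ n, MeasurableSpace (Ω n)]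
    {P : ∀ n, Measure (Ω n)} {s : ∀ n, Set (Ω n)}
    (h : Tendsto (fun n => P n (s n)) atTop (𝓝 0)) :
    Tendsto (fun n => (P n).real (s n)) atTop (𝓝 0) :=
  (ENNReal.tendsto_toReal ENNReal.zero_ne_top).comp h

variable {c : ℕ} [NeZero c] {Ω : ℕ → Type*} [∀ n, MeasurableSpace (Ω n)]
  {P : ∀ n, Measure (Ω n)} [∀ n, IsProbabilityMeasure (P n)]
  {G : ∀ n, Ω n → SimpleGraph (Fin n)} {Y : ∀ n, Ω n → Fin n → Fin c}

lemma tendsto_integral_exp_normalizedCount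
    (hG : ∀ n, Measurable (G n)) (hY : ∀ n, IsUniformColoring (P n) (Y n))
    (hGY : ∀ n, IndepFun (G n) (Y n) (P n))
    (hE : TendstoInftyInProb P fun n ω => (edgeCount (G n ω) : ℝ)) (hA : ACF4InProb P G) (t : ℝ) :
    Tendsto (fun n => ∫ ω, Complex.exp (Complex.I *
        ((t * normalizedCount (G n ω) (Y n ω) : ℝ) : ℂ)) ∂(P n)) atTop
      (𝓝 (Real.exp (-((1 - 1 / (c : ℝ)) * t ^ 2) / 2))) := by
  set g : ℂ := (Real.exp (-((1 - 1 / (c : ℝ)) * t ^ 2) / 2) : ℂ) with hg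
  have hgn : ‖g‖ ≤ 1 := by
    have hc : (1 : ℝ) ≤ c := by exact_mod_cast NeZero.one_le
    have h1 : 1 / (c : ℝ) ≤ 1 := by rw [div_le_one (by positivity)]; exact hc
    have h2 : 0 ≤ 1 - 1 / (c : ℝ) := by linarith
    rw [hg, Complex.norm_real, Real.norm_of_nonneg (Real.exp_pos _).le, Real.exp_le_one_iff]
    have : 0 ≤ (1 - 1 / (c : ℝ)) * t ^ 2 := by positivity
    linarith
  rw [Metric.tendsto_atTop]
  intro ε hε
  obtain ⟨δ, hδ, M, hM, hbound⟩ := exists_norm_expect_exp_edgeForm_sub_le c t (half_pos hε)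
  -- Off this event the bound for fixed graphs applies, the 256 converting copies to labelled
  -- cycles; on it the trivial bound 2 is used.
  let bad : ∀ n, Set (Ω n) := fun n => {ω | (edgeCount (G n ω) : ℝ) ≤ M} ∪
    {ω | δ / 256 ≤ |(fourCycleCount (G n ω) : ℝ) / (edgeCount (G n ω) : ℝ) ^ 2|}
  have hbad : Tendsto (fun n => (P n).real (bad n)) atTop (𝓝 0) := by
    have h1 := (hE M).add (hA (δ / 256) (by positivity))
    rw [add_zero] at h1
    have h2 : Tendsto (fun n => P n (bad n)) atTop (𝓝 0) :=
      tendsto_of_tendsto_of_tendsto_of_le_of_le tendsto_const_nhds h1 (fun _ => zero_le)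
        fun n => measure_union_le _ _
    exact tendsto_measureReal_zero h2
  have hbm : ∀ n, MeasurableSet (bad n) := fun n =>
    (hG n) ((Set.toFinite ({H | (edgeCount H : ℝ) ≤ M} ∪
      {H | δ / 256 ≤ |(fourCycleCount H : ℝ) / (edgeCount H : ℝ) ^ 2|})).measurableSet)
  have hev : ∀ᶠ n in atTop, (P n).real (bad n) < ε / 4 :=
    hbad.eventually_lt_const (by positivity)
  obtain ⟨N, hN⟩ := eventually_atTop.1 hev
  refine ⟨N, fun n hn => ?_⟩
  have h1 := integral_graph_coloring_eq (hG n) (hY n) (hGY n) fun H y =>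
    Complex.exp (Complex.I * ((t * normalizedCount H y : ℝ) : ℂ))
  have h2 : ∀ ω, ‖𝔼 y : Fin n → Fin c,
      Complex.exp (Complex.I * ((t * normalizedCount (G n ω) y : ℝ) : ℂ)) - g‖ ≤
      ε / 2 + (bad n).indicator (fun _ => (2 : ℝ)) ω := by
    intro ω
    by_cases hω : ω ∈ bad n
    · rw [Set.indicator_of_mem hω]
      have h3 : ‖𝔼 y : Fin n → Fin c,
          Complex.exp (Complex.I * ((t * normalizedCount (G n ω) y : ℝ) : ℂ))‖ ≤ 1 := by
        refine (norm_expect_le_expect_norm _).trans ?_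
        simp only [Complex.norm_exp_I_mul_ofReal, Fintype.expect_const, le_refl]
      linarith [norm_sub_le (𝔼 y : Fin n → Fin c,
        Complex.exp (Complex.I * ((t * normalizedCount (G n ω) y : ℝ) : ℂ))) g]
    · rw [Set.indicator_of_notMem hω, add_zero]
      simp only [bad, Set.mem_union, Set.mem_ofPred_eq, not_or, not_le] at hω
      obtain ⟨hω1, hω2⟩ := hω
      rw [edgeCount_eq_edgeNum] at hω1 hω2
      have hm : 0 < edgeNum (G n ω) := hM.trans hω1
      rw [abs_of_nonneg (by positivity), div_lt_iff₀ (by positivity)] at hω2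
      simp_rw [normalizedCount_eq]
      refine hbound n (G n ω) hω1.le ?_
      have := cycleNum_le_mul_fourCycleCount (G n ω)
      linarith
  have h4 : Integrable (fun ω => 𝔼 y : Fin n → Fin c,
      Complex.exp (Complex.I * ((t * normalizedCount (G n ω) y : ℝ) : ℂ))) (P n) :=
    integrable_comp_of_finite (hG n) fun H => 𝔼 y : Fin n → Fin c,
      Complex.exp (Complex.I * ((t * normalizedCount H y : ℝ) : ℂ))
  have hind : Integrable ((bad n).indicator fun _ => (2 : ℝ)) (P n) :=
    (integrable_const _).indicator (hbm n)
  rw [dist_eq_norm, h1]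
  calc ‖∫ ω, 𝔼 y : Fin n → Fin c,
        Complex.exp (Complex.I * ((t * normalizedCount (G n ω) y : ℝ) : ℂ)) ∂(P n) - g‖
      = ‖∫ ω, (𝔼 y : Fin n → Fin c,
        Complex.exp (Complex.I * ((t * normalizedCount (G n ω) y : ℝ) : ℂ)) - g) ∂(P n)‖ := by
        rw [integral_sub h4 (integrable_const _)]
        simp
    _ ≤ ∫ ω, (ε / 2 + (bad n).indicator (fun _ => (2 : ℝ)) ω) ∂(P n) :=
        norm_integral_le_of_norm_le ((integrable_const _).add hind) (Eventually.of_forall h2)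
    _ = ε / 2 + 2 * (P n).real (bad n) := by
        rw [integral_add (integrable_const _) hind, integral_indicator (hbm n)]
        simp [mul_comm]
    _ < ε := by linarith [hN n hn]

lemma integral_normalizedCount_pow_six_le {n : ℕ} (hG : Measurable (G n))
    (hY : IsUniformColoring (P n) (Y n)) (hGY : IndepFun (G n) (Y n) (P n)) :
    ∫ ω, normalizedCount (G n ω) (Y n ω) ^ 6 ∂(P n) ≤ (100 * (c : ℝ)) ^ 3 := by
  rw [integral_graph_coloring_eq hG hY hGY fun H y => normalizedCount H y ^ 6]
  calc _ ≤ ∫ _, (100 * (c : ℝ)) ^ 3 ∂(P n) :=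
        integral_mono (integrable_comp_of_finite hG fun H =>
          𝔼 y : Fin n → Fin c, normalizedCount H y ^ 6) (integrable_const _)
          fun ω => expect_normalizedCount_pow_six_le (G n ω)
    _ = _ := by simp

lemma integral_fourCycle_ratio_le (hc : 2 ≤ c) {n : ℕ} (hG : Measurable (G n))
    (hY : IsUniformColoring (P n) (Y n)) (hGY : IndepFun (G n) (Y n) (P n)) {M : ℝ} (hM : 1 ≤ M) :
    3 * (1 - 1 / (c : ℝ)) ^ 2 * (1 - 1 / M - (P n).real {ω | (edgeCount (G n ω) : ℝ) ≤ M}) +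
      1 / (c : ℝ) ^ 2 * ∫ ω, (fourCycleCount (G n ω) : ℝ) / (edgeCount (G n ω) : ℝ) ^ 2 ∂(P n) ≤
    ∫ ω, normalizedCount (G n ω) (Y n ω) ^ 4 ∂(P n) := by
  classical
  rw [integral_graph_coloring_eq hG hY hGY fun H y => normalizedCount H y ^ 4]
  have hms : MeasurableSet {ω | (edgeCount (G n ω) : ℝ) ≤ M} :=
    hG (Set.toFinite {H | (edgeCount H : ℝ) ≤ M}).measurableSet
  have i1 : Integrable (fun ω => if (edgeCount (G n ω) : ℝ) ≤ M then (1 : ℝ) else 0) (P n) :=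
    integrable_comp_of_finite hG fun H => if (edgeCount H : ℝ) ≤ M then (1 : ℝ) else 0
  have i2 : Integrable (fun ω => (fourCycleCount (G n ω) : ℝ) / (edgeCount (G n ω) : ℝ) ^ 2)
      (P n) :=
    integrable_comp_of_finite hG fun H => (fourCycleCount H : ℝ) / (edgeCount H : ℝ) ^ 2
  have e1 : ∫ ω, (if (edgeCount (G n ω) : ℝ) ≤ M then (1 : ℝ) else 0) ∂(P n) =
      (P n).real {ω | (edgeCount (G n ω) : ℝ) ≤ M} := by
    rw [← integral_indicator_one hms]
    congr 1
  have i3 : Integrable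
      (fun ω => 1 - 1 / M - if (edgeCount (G n ω) : ℝ) ≤ M then (1 : ℝ) else 0) (P n) :=
    (integrable_const _).sub i1
  calc _ = ∫ ω, (3 * (1 - 1 / (c : ℝ)) ^ 2 *
        (1 - 1 / M - (if (edgeCount (G n ω) : ℝ) ≤ M then 1 else 0)) +
        1 / (c : ℝ) ^ 2 *
          ((fourCycleCount (G n ω) : ℝ) / (edgeCount (G n ω) : ℝ) ^ 2)) ∂(P n) := by
        rw [integral_add (i3.const_mul _) (i2.const_mul _),
          integral_const_mul, integral_const_mul, integral_sub (integrable_const _) i1, e1]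
        simp
    _ ≤ _ := by
        refine integral_mono ((i3.const_mul _).add (i2.const_mul _))
          (integrable_comp_of_finite hG fun H =>
            𝔼 y : Fin n → Fin c, normalizedCount H y ^ 4) fun ω => ?_
        have h := le_expect_normalizedCount_pow_four hc (G n ω) hM
        rwa [← edgeCount_eq_edgeNum] at h

/-- Convergence in distribution to the Gaussian bounds the limit of the fourth moments, since the
sixth moments are bounded. -/
lemma eventually_integral_pow_four_le (hc : 2 ≤ c) {v : NNReal}
    (hG : ∀ n, Measurable (G n)) (hY : ∀ n, IsUniformColoring (P n) (Y n))
    (hGY : ∀ n, IndepFun (G n) (Y n) (P n))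
    (hD : TendstoInDistribution (fun n ω => normalizedCount (G n ω) (Y n ω)) atTop
      (id : ℝ → ℝ) P (gaussianReal 0 v)) {ε : ℝ} (hε : 0 < ε) :
    ∀ᶠ n in atTop, ∫ ω, normalizedCount (G n ω) (Y n ω) ^ 4 ∂(P n) ≤ 3 * (v : ℝ) ^ 2 + ε := by
  set C : ℝ := (100 * (c : ℝ)) ^ 3 with hC
  have hC0 : 0 ≤ C := by positivity
  -- Truncating x⁴ at R² costs at most x⁶/R pointwise, hence at most C/R ≤ ε/2 in mean.
  set R : ℝ := 2 * C / ε + 1 with hR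
  have hR1 : 1 ≤ R := by
    have : 0 ≤ 2 * C / ε := by positivity
    linarith
  have hCR : C / R ≤ ε / 2 := by
    rw [div_le_iff₀ (by linarith)]
    have : ε * R = 2 * C + ε := by rw [hR]; field_simp
    linarith
  let φ : BoundedContinuousFunction ℝ ℝ :=
    BoundedContinuousFunction.ofNormedAddCommGroup (fun x => min (x ^ 4) (R ^ 2)) (by fun_prop)
      (R ^ 2) fun x => by
        rw [Real.norm_of_nonneg (le_min (by positivity) (by positivity))]
        exact min_le_right _ _
  have hφ : ∀ x, φ x = min (x ^ 4) (R ^ 2) := fun _ => rfl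
  have ht := (ProbabilityMeasure.tendsto_iff_forall_integral_tendsto.1 hD.tendsto) φ
  simp only [ProbabilityMeasure.coe_mk, Measure.map_id] at ht
  have hlim : ∫ x, φ x ∂(gaussianReal 0 v) ≤ 3 * (v : ℝ) ^ 2 := by
    rw [← integral_pow_four_gaussianReal v]
    refine integral_mono (φ.integrable _) ?_ fun x => by rw [hφ]; exact min_le_left _ _
    have := (memLp_id_gaussianReal (μ := 0) (v := v) 4).integrable_norm_pow (by norm_num)
    refine this.congr (Eventually.of_forall fun x => ?_)
    simp only [id, Real.norm_eq_abs]
    exact Even.pow_abs (by decide) x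
  have hev := ht.eventually_lt_const
    (show ∫ x, φ x ∂(gaussianReal 0 v) < 3 * (v : ℝ) ^ 2 + ε / 2 by linarith)
  filter_upwards [hev] with n hn
  have hXm := measurable_normalizedCount (hG n) (hY n).measurable
  rw [integral_map hXm.aemeasurable φ.continuous.aestronglyMeasurable] at hn
  have hint : ∀ F : ℝ → ℝ, Integrable (fun ω => F (normalizedCount (G n ω) (Y n ω))) (P n) :=
    fun F => integrable_comp_of_finite ((hG n).prodMk (hY n).measurable)
      fun p : SimpleGraph (Fin n) × (Fin n → Fin c) => F (normalizedCount p.1 p.2)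
  have h6 := integral_normalizedCount_pow_six_le (hG n) (hY n) (hGY n)
  have hpt : ∀ x : ℝ, x ^ 4 ≤ φ x + x ^ 6 / R := by
    intro x
    rw [hφ]
    rcases le_total (x ^ 4) (R ^ 2) with h | h
    · rw [min_eq_left h]
      have : 0 ≤ x ^ 6 / R := by positivity
      linarith
    · have hx : R ≤ x ^ 2 := by
        refine le_of_sq_le_sq ?_ (sq_nonneg x)
        rw [← pow_mul]; exact h
      have : x ^ 4 ≤ x ^ 6 / R := by
        rw [le_div_iff₀ (by linarith)]
        have : x ^ 4 * R ≤ x ^ 4 * x ^ 2 := by gcongr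
        calc _ ≤ _ := this
          _ = x ^ 6 := by ring
      have : 0 ≤ min (x ^ 4) (R ^ 2) := le_min (by positivity) (by positivity)
      linarith
  calc ∫ ω, normalizedCount (G n ω) (Y n ω) ^ 4 ∂(P n)
      ≤ ∫ ω, (φ (normalizedCount (G n ω) (Y n ω)) + normalizedCount (G n ω) (Y n ω) ^ 6 / R)
        ∂(P n) :=
        integral_mono (hint fun x => x ^ 4) (hint fun x => φ x + x ^ 6 / R) fun ω => hpt _
    _ = ∫ ω, φ (normalizedCount (G n ω) (Y n ω)) ∂(P n) +
        (∫ ω, normalizedCount (G n ω) (Y n ω) ^ 6 ∂(P n)) / R := by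
        rw [integral_add (hint φ) (hint fun x => x ^ 6 / R), integral_div]
    _ ≤ (3 * (v : ℝ) ^ 2 + ε / 2) + C / R := by gcongr
    _ ≤ _ := by linarith

/-- The upper and lower bounds for the fourth moment share the leading term 3(1 - 1/c)². Their
comparison forces the mean of the 4-cycle ratio to 0, and Markov's inequality finishes. -/
lemma acf4InProb_of_tendstoInDistribution (hc : 2 ≤ c)
    (hG : ∀ n, Measurable (G n)) (hY : ∀ n, IsUniformColoring (P n) (Y n))
    (hGY : ∀ n, IndepFun (G n) (Y n) (P n))
    (hE : TendstoInftyInProb P fun n ω => (edgeCount (G n ω) : ℝ))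
    (hD : TendstoInDistribution (fun n ω => normalizedCount (G n ω) (Y n ω)) atTop
      (id : ℝ → ℝ) P (gaussianReal 0 (Real.toNNReal (1 - 1 / (c : ℝ))))) :
    ACF4InProb P G := by
  have hc' : (0 : ℝ) < c := by exact_mod_cast NeZero.pos c
  have hc1 : (1 : ℝ) ≤ c := by exact_mod_cast NeZero.one_le
  have hv0 : 0 ≤ 1 - 1 / (c : ℝ) := by
    have : 1 / (c : ℝ) ≤ 1 := by rw [div_le_one hc']; exact hc1
    linarith
  have hv1 : (1 - 1 / (c : ℝ)) ^ 2 ≤ 1 := by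
    have : 0 ≤ 1 / (c : ℝ) := by positivity
    nlinarith
  set I : ℕ → ℝ := fun n => ∫ ω, (fourCycleCount (G n ω) : ℝ) / (edgeCount (G n ω) : ℝ) ^ 2 ∂(P n)
    with hI
  have hI0 : ∀ n, 0 ≤ I n := fun n => integral_nonneg fun ω => by positivity
  have hlim : Tendsto I atTop (𝓝 0) := by
    rw [Metric.tendsto_atTop]
    intro ε hε
    set ε' := ε / (c : ℝ) ^ 2 with hε'
    have hε'0 : 0 < ε' := by positivity
    -- The error budget is ε'/4 from the upper bound and 3(ε'/12 + ε'/12) from the lower one, in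
    -- total 3ε'/4.
    set M : ℝ := 1 + 12 / ε' with hM
    have hM1 : 1 ≤ M := by
      have : 0 ≤ 12 / ε' := by positivity
      linarith
    have hMi : 1 / M ≤ ε' / 12 := by
      rw [div_le_iff₀ (by linarith)]
      have : ε' / 12 * M = ε' / 12 + 1 := by rw [hM]; field_simp
      linarith
    have h4 := eventually_integral_pow_four_le hc hG hY hGY hD (ε := ε' / 4) (by positivity)
    have hP : Tendsto (fun n => (P n).real {ω | (edgeCount (G n ω) : ℝ) ≤ M}) atTop (𝓝 0) :=
      tendsto_measureReal_zero (hE M)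
    have hP' := hP.eventually_lt_const (show 0 < ε' / 12 by positivity)
    obtain ⟨N, hN⟩ := eventually_atTop.1 (h4.and hP')
    refine ⟨N, fun n hn => ?_⟩
    obtain ⟨a1, a2⟩ := hN n hn
    have h := integral_fourCycle_ratio_le hc (hG n) (hY n) (hGY n) hM1
    rw [Real.coe_toNNReal _ hv0] at a1
    rw [Real.dist_eq, sub_zero, abs_of_nonneg (hI0 n)]
    have b1 : 3 * (1 - 1 / (c : ℝ)) ^ 2 *
        (1 / M + (P n).real {ω | (edgeCount (G n ω) : ℝ) ≤ M}) ≤ 3 * 1 * (ε' / 12 + ε' / 12) := by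
      gcongr
    have b2 : 1 / (c : ℝ) ^ 2 * I n < ε' := by
      have : 1 / (c : ℝ) ^ 2 * I n ≤ ε' / 4 + ε' / 2 := by
        simp only [hI]
        linarith
      linarith
    rw [hε', one_div_mul_eq_div] at b2
    exact (div_lt_div_iff_of_pos_right (by positivity)).1 b2
  intro ε hε
  have hreal : Tendsto (fun n => (P n).real
      {ω | ε ≤ |(fourCycleCount (G n ω) : ℝ) / (edgeCount (G n ω) : ℝ) ^ 2|}) atTop (𝓝 0) := by
    have h2 := hlim.div_const ε
    rw [zero_div] at h2
    refine tendsto_of_tendsto_of_tendsto_of_le_of_le tendsto_const_nhds h2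
      (fun _ => measureReal_nonneg) fun n => ?_
    rw [le_div_iff₀ hε, mul_comm]
    have hi := integrable_comp_of_finite (P := P n) (hG n)
      fun H => (fourCycleCount H : ℝ) / (edgeCount H : ℝ) ^ 2
    have h0 : ∀ ω, 0 ≤ (fourCycleCount (G n ω) : ℝ) / (edgeCount (G n ω) : ℝ) ^ 2 := fun ω => by
      positivity
    have := mul_meas_ge_le_integral_of_nonneg (Eventually.of_forall h0) hi ε
    simp_rw [fun ω => abs_of_nonneg (h0 ω)]
    exact this
  have h3 := ENNReal.tendsto_ofReal hreal
  simpa [measureReal_def] using h3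

lemma tendstoInDistribution_of_acf4InProb
    (hG : ∀ n, Measurable (G n)) (hY : ∀ n, IsUniformColoring (P n) (Y n))
    (hGY : ∀ n, IndepFun (G n) (Y n) (P n))
    (hE : TendstoInftyInProb P fun n ω => (edgeCount (G n ω) : ℝ)) (hA : ACF4InProb P G) :
    TendstoInDistribution (fun n ω => normalizedCount (G n ω) (Y n ω)) atTop
      (id : ℝ → ℝ) P (gaussianReal 0 (Real.toNNReal (1 - 1 / (c : ℝ)))) := by
  have hc1 : (1 : ℝ) ≤ c := by exact_mod_cast NeZero.one_le
  have hv0 : 0 ≤ 1 - 1 / (c : ℝ) := by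
    have : 1 / (c : ℝ) ≤ 1 := by rw [div_le_one (by linarith)]; exact hc1
    linarith
  have hXm : ∀ n, Measurable fun ω => normalizedCount (G n ω) (Y n ω) := fun n =>
    measurable_normalizedCount (hG n) (hY n).measurable
  refine ⟨fun n => (hXm n).aemeasurable, aemeasurable_id, ?_⟩
  -- Lévy's continuity theorem.
  refine ProbabilityMeasure.tendsto_iff_tendsto_charFun.2 fun t => ?_
  have h := tendsto_integral_exp_normalizedCount hG hY hGY hE hA t
  simp only [ProbabilityMeasure.coe_mk, Measure.map_id, charFun_gaussianReal]
  convert h using 2 with n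
  · rw [charFun_apply_real, integral_map (hXm n).aemeasurable (by fun_prop)]
    refine integral_congr_ae (Eventually.of_forall fun ω => ?_)
    simp only
    congr 1
    push_cast
    ring
  · rw [Complex.ofReal_exp, Real.coe_toNNReal _ hv0]
    congr 1
    push_cast
    ring

end Limit

end MonoEdges

theorem theorem1p3 (c : ℕ) (hc : 2 ≤ c)
    {Ω : ℕ → Type*} [∀ n, MeasurableSpace (Ω n)]
    (P : ∀ n, Measure (Ω n)) [∀ n, IsProbabilityMeasure (P n)]
    (G : ∀ n, Ω n → SimpleGraph (Fin n)) (Y : ∀ n, Ω n → Fin n → Fin c)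
    (hG : ∀ n, Measurable (G n))
    (hY : ∀ n, MonoEdges.IsUniformColoring (P n) (Y n))
    (hGY : ∀ n, IndepFun (G n) (Y n) (P n))
    (hE : MonoEdges.TendstoInftyInProb P (fun n ω => (MonoEdges.edgeCount (G n ω) : ℝ))) :
    TendstoInDistribution (fun n ω => MonoEdges.normalizedCount (G n ω) (Y n ω)) atTop
        (id : ℝ → ℝ) P (gaussianReal 0 (Real.toNNReal (1 - 1 / (c : ℝ))))
      ↔ MonoEdges.ACF4InProb P G := by
  have : NeZero c := ⟨by omega⟩
  exact ⟨MonoEdges.acf4InProb_of_tendstoInDistribution hc hG hY hGY hE,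
    MonoEdges.tendstoInDistribution_of_acf4InProb hG hY hGY hE⟩
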